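/- All algebras are complex. Let $\Omega$ be a locally compact Hausdorff space and let $\mathcal{U}=\{\Omega,(A_x)_{x\in\Omega},\Theta\}$ be a continuous field of Banach algebras: each $A_x$ is a (not necessarily unital) Banach algebra and $\Theta$ is a subalgebra of $\prod_{x}A_x$ such that (1) $\{a(x):a\in\Theta\}$ is dense in $A_x$ for every $x$; (2) $x\mapsto\|a(x)\|$ is continuous for every $a\in\Theta$; (3) if $b\in\prod_x A_x$ and for all $x\in\Omega$, $\varepsilon>0$ there is $b'\in\Theta$ with $\|b-b'\|\le\varepsilon$ throughout a neighbourhood of $x$, then $b\in\Theta$. Let $\mathfrak{A}=\{a\in\Theta:\|a(x)\|\to0 \text{ at infinity}\}$, with the norm $\|a\|=\sup_x\|a(x)\|$, be the Banach algebra defined by $\mathcal{U}$. For $Y\subseteq\Omega$ the induced field $\mathcal{U}|_Y$ has the fibres $A_x$ $(x\in Y)$, and its continuous vector fields are the $b\in\prod_{x\in Y}A_x$ such that for all $x\in Y$, $\varepsilon>0$ there is $b'\in\Theta$ with $\|b-b'\|\le\varepsilon$ throughout a neighbourhood of $x$ in $Y$. The field $\mathcal{U}$ is locally trivial if every point of $\Omega$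 has a neighbourhood $V$ such that $\mathcal{U}|_V$ is isomorphic (by fibrewise isometric algebra isomorphisms carrying the continuous vector fields onto the continuous vector fields) to the constant field over $V$ defined by some Banach algebra $B$, whose continuous vector fields are the continuous maps $V\to B$. For a Banach algebra $A$ let $A_+$ be $A$ with an identity adjoined and $\|\lambda e+a\|=|\lambda|+\|a\|$. The algebras $A_x$, $x\in\Omega$, are uniformly left projective if there are morphisms of left Banach $A_x$-modules $\rho_x:A_x\to(A_x)_+\widehat\otimes A_x$ with $\pi_x\circ\rho_x=\mathrm{id}_{A_x}$ for every $x\in\Omega$, where $\pi_x(u\otimes a)=ua$, and $\sup_x\|\rho_x\|<\infty$; they are uniformly right projective if there are morphisms of right Banach $A_x$-modules $\rho_x:A_x\to A_x\widehat\otimes(A_x)_+$ with $\pi_x\circ\rho_x=\mathrm{id}_{A_x}$ for every $x\in\Omega$, where $\pi_x(a\otimes u)=au$, and $\sup_x\|\rho_x\|<\infty$. **Proposition.** Suppose that either (a) $\mathfrak{A}$ has a right or a left bounded approximate identity (a bounded net $(e_\nu)$ with $ae_\nu\to a$ for all $a\in\mathfrak A$, respectively $e_\nu a\to a$ for all $a\in\mathfrak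 A$); or (b) $\mathcal{U}$ is locally trivial. Suppose also that the Banach algebras $A_x$, $x\in\Omega$, are not uniformly left projective or are not uniformly right projective. Then (i) there is a Banach $\mathfrak{A}$-bimodule $X$ with $\mathcal{H}^2(\mathfrak{A},X)\neq\{0\}$, where $\mathcal{H}^2(\mathfrak{A},X)$ is the second continuous Hochschild cohomology group: the bounded bilinear maps $f:\mathfrak{A}\times\mathfrak{A}\to X$ with $a\cdot f(b,c)-f(ab,c)+f(a,bc)-f(a,b)\cdot c=0$ for all $a,b,c$, modulo those of the form $f(a,b)=a\cdot g(b)-g(ab)+g(a)\cdot b$ with $g:\mathfrak{A}\to X$ bounded linear; and (ii) $\mathfrak{A}$ has a strongly unsplittable singular extension: there are a Banach algebra $\mathfrak{B}$ and a continuous surjective homomorphism $\pi:\mathfrak{B}\to\mathfrak{A}$ whose kernel $I$ satisfies $I^2=\{0\}$ and is complemented in the Banach space $\mathfrak{B}$, such that there is no continuous algebra homomorphism $\theta:\mathfrak{A}\to\mathfrak{B}$ with $\pi\circ\theta=\mathrm{id}_{\mathfrak{A}}$. -/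

import Mathlib

open Filter Topology
open scoped TensorProduct ENNReal

universe u v

noncomputable section

namespace BanachFields

/-! ### The projective tensor product of Banach spaces -/

section ProjectiveTensor

variable (E F : Type*) [NormedAddCommGroup E] [NormedSpace ℂ E]
  [NormedAddCommGroup F] [NormedSpace ℂ F]

/-- The algebraic tensor product of two normed spaces, as a carrier for the projective norm. -/
def AlgTensor := E ⊗[ℂ] F

instance : AddCommGroup (AlgTensor E F) := inferInstanceAs (AddCommGroup (E ⊗[ℂ] F))

instance : Module ℂ (AlgTensor E F) := inferInstanceAs (Module ℂ (E ⊗[ℂ] F))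

variable {E F}

/-- The elementary tensor `x ⊗ y`. -/
def algTmul (x : E) (y : F) : AlgTensor E F := x ⊗ₜ[ℂ] y

/-- The element `∑ xᵢ ⊗ yᵢ` represented by a finite list of pairs `(xᵢ, yᵢ)`. -/
def tensorOfList (l : List (E × F)) : AlgTensor E F :=
  (l.map fun p => algTmul p.1 p.2).sum

theorem tensorOfList_cons (p : E × F) (l : List (E × F)) :
    tensorOfList (p :: l) = algTmul p.1 p.2 + tensorOfList l := by
  simp [tensorOfList]

theorem tensorOfList_append (l m : List (E × F)) :
    tensorOfList (l ++ m) = tensorOfList l + tensorOfList m := by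
  simp [tensorOfList]

theorem smul_tensorOfList (c : ℂ) (l : List (E × F)) :
    c • tensorOfList l = tensorOfList (l.map fun p => (c • p.1, p.2)) := by
  induction l with
  | nil => simp [tensorOfList]
  | cons p l ih =>
    rw [tensorOfList_cons, smul_add, ih, List.map_cons, tensorOfList_cons]
    rfl

/-- The cost `∑ ‖xᵢ‖ ‖yᵢ‖` of a finite list of pairs `(xᵢ, yᵢ)`. -/
def listCost (l : List (E × F)) : ℝ := (l.map fun p => ‖p.1‖ * ‖p.2‖).sum

theorem listCost_nonneg (l : List (E × F)) : 0 ≤ listCost l := by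
  apply List.sum_nonneg
  intro r hr
  obtain ⟨p, -, rfl⟩ := List.mem_map.1 hr
  positivity

theorem exists_tensorOfList (w : AlgTensor E F) : ∃ l, tensorOfList l = w := by
  refine TensorProduct.induction_on (motive := fun w => ∃ l, tensorOfList (E := E) (F := F) l = w)
    w ⟨[], rfl⟩ (fun x y => ⟨[(x, y)], ?_⟩) ?_
  · exact (tensorOfList_cons (x, y) []).trans (add_zero _)
  · rintro a b ⟨l, rfl⟩ ⟨m, rfl⟩
    exact ⟨l ++ m, tensorOfList_append l m⟩

/-- The projective norm `inf ∑ ‖xᵢ‖ ‖yᵢ‖`, the infimum being over all finite representations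
`w = ∑ xᵢ ⊗ yᵢ`. -/
def projNorm (w : AlgTensor E F) : ℝ := sInf (listCost '' {l | tensorOfList l = w})

theorem projNorm_bddBelow (w : AlgTensor E F) :
    BddBelow (listCost '' {l : List (E × F) | tensorOfList l = w}) :=
  ⟨0, by rintro _ ⟨l, -, rfl⟩; exact listCost_nonneg l⟩

theorem projNorm_le (l : List (E × F)) : projNorm (tensorOfList l) ≤ listCost l :=
  csInf_le (projNorm_bddBelow _) ⟨l, rfl, rfl⟩

theorem projNorm_nonneg (w : AlgTensor E F) : 0 ≤ projNorm w :=
  Real.sInf_nonneg (by rintro _ ⟨l, -, rfl⟩; exact listCost_nonneg l)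

theorem exists_listCost_lt (w : AlgTensor E F) {ε : ℝ} (hε : 0 < ε) :
    ∃ l, tensorOfList l = w ∧ listCost l < projNorm w + ε := by
  obtain ⟨l₀, hl₀⟩ := exists_tensorOfList w
  obtain ⟨_, ⟨l, hl, rfl⟩, h⟩ := exists_lt_of_csInf_lt (s := listCost '' {l | tensorOfList l = w})
    ⟨_, l₀, hl₀, rfl⟩ (lt_add_of_pos_right _ hε)
  exact ⟨l, hl, h⟩

theorem projNorm_add_le (w z : AlgTensor E F) : projNorm (w + z) ≤ projNorm w + projNorm z := by
  refine le_of_forall_pos_le_add fun ε hε => ?_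
  obtain ⟨l, rfl, hl⟩ := exists_listCost_lt w (half_pos hε)
  obtain ⟨m, rfl, hm⟩ := exists_listCost_lt z (half_pos hε)
  have h' : listCost (l ++ m) = listCost l + listCost m := by simp [listCost]
  rw [← tensorOfList_append]
  linarith [projNorm_le (l ++ m)]

theorem projNorm_smul_le (c : ℂ) (w : AlgTensor E F) : projNorm (c • w) ≤ ‖c‖ * projNorm w := by
  have key : ∀ l : List (E × F), projNorm (c • tensorOfList l) ≤ ‖c‖ * listCost l := by
    intro l
    have h' : listCost (l.map fun p => (c • p.1, p.2)) = ‖c‖ * listCost l := by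
      simp [listCost, Function.comp_def, norm_smul, mul_assoc, List.sum_map_mul_left]
    rw [smul_tensorOfList, ← h']
    exact projNorm_le _
  refine le_of_forall_pos_le_add fun ε hε => ?_
  obtain ⟨l, rfl, hl⟩ := exists_listCost_lt w (ε := ε / (‖c‖ + 1)) (by positivity)
  have h1 : ‖c‖ * (ε / (‖c‖ + 1)) ≤ ε := by
    rw [mul_div_assoc', div_le_iff₀ (by positivity)]
    nlinarith [norm_nonneg c]
  nlinarith [key l, mul_le_mul_of_nonneg_left hl.le (norm_nonneg c)]

theorem projNorm_zero : projNorm (0 : AlgTensor E F) = 0 :=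
  le_antisymm (projNorm_le (E := E) (F := F) []) (projNorm_nonneg _)

variable (E F)

/-- The projective seminorm. -/
def projSeminorm : Seminorm ℂ (AlgTensor E F) :=
  Seminorm.ofSMulLE projNorm projNorm_zero projNorm_add_le projNorm_smul_le

instance : SeminormedAddCommGroup (AlgTensor E F) :=
  (projSeminorm E F).toAddGroupSeminorm.toSeminormedAddCommGroup

instance : NormedSpace ℂ (AlgTensor E F) where
  norm_smul_le c w := projNorm_smul_le c w

/-- The projective tensor product `E ⊗̂ F`: the completion of the algebraic tensor product in the
projective norm. -/
abbrev ProjTensor := UniformSpace.Completion (AlgTensor E F)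

variable {E F} {G : Type*} [NormedAddCommGroup G] [NormedSpace ℂ G]

theorem norm_algLift_le (B : E →L[ℂ] F →L[ℂ] G) (w : AlgTensor E F) :
    ‖TensorProduct.lift ((ContinuousLinearMap.coeLM ℂ).comp (B : E →ₗ[ℂ] F →L[ℂ] G)) w‖
      ≤ ‖B‖ * ‖w‖ := by
  set L := TensorProduct.lift ((ContinuousLinearMap.coeLM ℂ).comp (B : E →ₗ[ℂ] F →L[ℂ] G))
  have key : ∀ l : List (E × F), ‖L (tensorOfList l)‖ ≤ ‖B‖ * listCost l := by
    intro l
    induction l with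
    | nil =>
      have h0 : L (tensorOfList []) = 0 := map_zero L
      simp [h0, listCost]
    | cons p l ih =>
      have h1 : L (tensorOfList (p :: l)) = B p.1 p.2 + L (tensorOfList l) := by
        rw [tensorOfList_cons]
        refine (map_add L (algTmul p.1 p.2) (tensorOfList l)).trans ?_
        congr 1
      have h2 : listCost (p :: l) = ‖p.1‖ * ‖p.2‖ + listCost l := by simp [listCost]
      rw [h1, h2]
      refine (norm_add_le _ _).trans ?_
      have := B.le_opNorm₂ p.1 p.2
      nlinarith
  refine le_of_forall_pos_le_add fun ε hε => ?_
  obtain ⟨l, rfl, hl⟩ := exists_listCost_lt w (ε := ε / (‖B‖ + 1)) (by positivity)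
  have h1 : ‖B‖ * (ε / (‖B‖ + 1)) ≤ ε := by
    rw [mul_div_assoc', div_le_iff₀ (by positivity)]
    nlinarith [norm_nonneg B]
  have h2 : ‖tensorOfList l‖ = projNorm (tensorOfList l) := rfl
  rw [h2]
  nlinarith [key l, mul_le_mul_of_nonneg_left hl.le (norm_nonneg B)]

/-- The bounded linear map on the algebraic tensor product induced by a bounded bilinear map. -/
def algLift (B : E →L[ℂ] F →L[ℂ] G) : AlgTensor E F →L[ℂ] G :=
  LinearMap.mkContinuous
    (TensorProduct.lift ((ContinuousLinearMap.coeLM ℂ).comp (B : E →ₗ[ℂ] F →L[ℂ] G)) :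
      E ⊗[ℂ] F →ₗ[ℂ] G) ‖B‖ (norm_algLift_le B)

/-- The bounded linear map `E ⊗̂ F → G`, `x ⊗ y ↦ B x y`, induced by a bounded bilinear map. -/
def ProjTensor.lift [CompleteSpace G] (B : E →L[ℂ] F →L[ℂ] G) : ProjTensor E F →L[ℂ] G :=
  (algLift B).extend (UniformSpace.Completion.toComplL : AlgTensor E F →L[ℂ] ProjTensor E F)

variable (E F) in
/-- The canonical bounded bilinear map `(x, y) ↦ x ⊗ y`. -/
def ProjTensor.mk : E →L[ℂ] F →L[ℂ] ProjTensor E F :=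
  LinearMap.mkContinuous₂
    ((TensorProduct.mk ℂ E F).compr₂
      ((UniformSpace.Completion.toComplL : AlgTensor E F →L[ℂ] ProjTensor E F) :
        AlgTensor E F →ₗ[ℂ] ProjTensor E F)) 1 (by
    intro x y
    refine le_trans (le_of_eq (UniformSpace.Completion.norm_coe (algTmul x y))) ?_
    have h := projNorm_le [(x, y)]
    simp only [tensorOfList, listCost, List.map_cons, List.map_nil, List.sum_cons, List.sum_nil,
      add_zero] at h
    rw [one_mul]
    exact h)

theorem ProjTensor.lift_mk [CompleteSpace G] (B : E →L[ℂ] F →L[ℂ] G) (x : E) (y : F) :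
    ProjTensor.lift B (ProjTensor.mk E F x y) = B x y := by
  have h := ContinuousLinearMap.extend_eq (algLift B)
    (e := (UniformSpace.Completion.toComplL : AlgTensor E F →L[ℂ] ProjTensor E F))
    UniformSpace.Completion.denseRange_coe
    (UniformSpace.Completion.isUniformInducing_coe _) (algTmul x y)
  exact h

variable {E' F' : Type*} [NormedAddCommGroup E'] [NormedSpace ℂ E']
  [NormedAddCommGroup F'] [NormedSpace ℂ F']

/-- The bounded linear map `S ⊗ T : E ⊗̂ F → E' ⊗̂ F'`, `x ⊗ y ↦ S x ⊗ T y`. -/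
def ProjTensor.map (S : E →L[ℂ] E') (T : F →L[ℂ] F') : ProjTensor E F →L[ℂ] ProjTensor E' F' :=
  ProjTensor.lift ((ProjTensor.mk E' F').bilinearComp S T)

theorem ProjTensor.map_mk (S : E →L[ℂ] E') (T : F →L[ℂ] F') (x : E) (y : F) :
    ProjTensor.map S T (ProjTensor.mk E F x y) = ProjTensor.mk E' F' (S x) (T y) := by
  simp [ProjTensor.map, ProjTensor.lift_mk]

end ProjectiveTensor

/-! ### Projectivity of a Banach algebra over itself -/

section Projectivity

variable (A : Type*) [NonUnitalNormedRing A] [NormedSpace ℂ A] [IsScalarTower ℂ A A]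
  [SMulCommClass ℂ A A]

/-- The Banach algebra `A₊` obtained from `A` by adjoining an identity (whether or not `A` has one),
with the norm `‖λe + a‖ = |λ| + ‖a‖`. -/
abbrev AdjoinOne := WithLp 1 (Unitization ℂ A)

variable {A}

/-- The inclusion of `A` in `A₊`. -/
def AdjoinOne.incl (a : A) : AdjoinOne A := WithLp.toLp 1 (a : Unitization ℂ A)

variable (A)

/-- The bounded bilinear map `A₊ × A → A`, `(λe + a, x) ↦ λx + ax`. -/
def unitizationLeftMul : AdjoinOne A →L[ℂ] A →L[ℂ] A :=
  LinearMap.mkContinuous₂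
    (LinearMap.mk₂ ℂ (fun (p : AdjoinOne A) (x : A) => p.ofLp.fst • x + p.ofLp.snd * x)
      (by intro p q x; simp [add_smul, add_mul]; abel)
      (by intro c p x; simp [smul_smul, smul_add, smul_mul_assoc])
      (by intro p x y; simp [smul_add, mul_add]; abel)
      (by intro c p x; simp [smul_comm c, smul_add, mul_smul_comm])) 1 (by
    intro p x
    rw [WithLp.unitization_norm_def, one_mul, add_mul, ← norm_smul]
    exact (norm_add_le _ _).trans (add_le_add le_rfl (norm_mul_le _ _)))

/-- The bounded bilinear map `A × A₊ → A`, `(x, λe + a) ↦ λx + xa`. -/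
def unitizationRightMul : A →L[ℂ] AdjoinOne A →L[ℂ] A :=
  LinearMap.mkContinuous₂
    (LinearMap.mk₂ ℂ (fun (x : A) (p : AdjoinOne A) => p.ofLp.fst • x + x * p.ofLp.snd)
      (by intro x y p; simp [smul_add, add_mul]; abel)
      (by intro c x p; simp [smul_comm c, smul_add, smul_mul_assoc])
      (by intro x p q; simp [add_smul, mul_add]; abel)
      (by intro c x p; simp [smul_smul, smul_add, mul_smul_comm])) 1 (by
    intro x p
    rw [WithLp.unitization_norm_def, one_mul, mul_comm, add_mul, ← norm_smul]
    exact (norm_add_le _ _).trans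
      (add_le_add le_rfl ((norm_mul_le _ _).trans_eq (mul_comm _ _))))

variable {A}

/-- `ρ : A → A₊ ⊗̂ A` is a morphism of left Banach `A`-modules that is a right inverse of the
canonical morphism `π : A₊ ⊗̂ A → A`, `u ⊗ x ↦ u · x`. The left action of `a` on `A₊ ⊗̂ A` is
`a · (u ⊗ x) = au ⊗ x`. -/
structure IsLeftProjectiveSection [CompleteSpace A] (ρ : A →L[ℂ] ProjTensor (AdjoinOne A) A) :
    Prop where
  map_mul : ∀ a b : A, ρ (a * b) =
    ProjTensor.map (ContinuousLinearMap.mul ℂ (AdjoinOne A) (AdjoinOne.incl a))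
      (ContinuousLinearMap.id ℂ A) (ρ b)
  right_inv : ∀ b : A, ProjTensor.lift (unitizationLeftMul A) (ρ b) = b

/-- `ρ : A → A ⊗̂ A₊` is a morphism of right Banach `A`-modules that is a right inverse of the
canonical morphism `π : A ⊗̂ A₊ → A`, `x ⊗ u ↦ x · u`. The right action of `a` on `A ⊗̂ A₊` is
`(x ⊗ u) · a = x ⊗ ua`. -/
structure IsRightProjectiveSection [CompleteSpace A] (ρ : A →L[ℂ] ProjTensor A (AdjoinOne A)) :
    Prop where
  map_mul : ∀ b a : A, ρ (b * a) =
    ProjTensor.map (ContinuousLinearMap.id ℂ A)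
      ((ContinuousLinearMap.mul ℂ (AdjoinOne A)).flip (AdjoinOne.incl a)) (ρ b)
  right_inv : ∀ b : A, ProjTensor.lift (unitizationRightMul A) (ρ b) = b

/-- A right bounded approximate identity: a bounded net `(e_ν)` with `a e_ν → a` for all `a`. The
net is encoded by its filter of tails. -/
def HasRightBoundedApproxId (A : Type*) [NonUnitalNormedRing A] : Prop :=
  ∃ l : Filter A, l.NeBot ∧ (∃ C : ℝ, ∀ᶠ e in l, ‖e‖ ≤ C) ∧
    ∀ a : A, Tendsto (fun e => a * e) l (𝓝 a)

/-- A left bounded approximate identity: a bounded net `(e_ν)` with `e_ν a → a` for all `a`. -/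
def HasLeftBoundedApproxId (A : Type*) [NonUnitalNormedRing A] : Prop :=
  ∃ l : Filter A, l.NeBot ∧ (∃ C : ℝ, ∀ᶠ e in l, ‖e‖ ≤ C) ∧
    ∀ a : A, Tendsto (fun e => e * a) l (𝓝 a)

end Projectivity

section UniformProjectivity

variable {Ω : Type u} (A : Ω → Type v) [∀ t, NonUnitalNormedRing (A t)]
  [∀ t, NormedSpace ℂ (A t)] [∀ t, IsScalarTower ℂ (A t) (A t)]
  [∀ t, SMulCommClass ℂ (A t) (A t)] [∀ t, CompleteSpace (A t)]

/-- The Banach algebras `A t` are uniformly left projective. -/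
def UniformlyLeftProjective : Prop :=
  ∃ ρ : ∀ t, A t →L[ℂ] ProjTensor (AdjoinOne (A t)) (A t),
    (∀ t, IsLeftProjectiveSection (ρ t)) ∧ BddAbove (Set.range fun t => ‖ρ t‖)

/-- The Banach algebras `A t` are uniformly right projective. -/
def UniformlyRightProjective : Prop :=
  ∃ ρ : ∀ t, A t →L[ℂ] ProjTensor (A t) (AdjoinOne (A t)),
    (∀ t, IsRightProjectiveSection (ρ t)) ∧ BddAbove (Set.range fun t => ‖ρ t‖)

end UniformProjectivity

/-! ### Continuous fields of Banach algebras -/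

section Fields

/-- A continuous field of Banach algebras with base `Ω` and fibres `A t`; the elements of `carrier`
are the continuous vector fields. -/
structure ContinuousField (Ω : Type u) [TopologicalSpace Ω] (A : Ω → Type v)
    [∀ t, NonUnitalNormedRing (A t)] [∀ t, NormedSpace ℂ (A t)]
    extends NonUnitalSubalgebra ℂ (∀ t, A t) where
  dense' : ∀ t, Dense {a : A t | ∃ x ∈ carrier, x t = a}
  continuous_norm' : ∀ x ∈ carrier, Continuous fun t => ‖x t‖
  mem_of_local' : ∀ x : ∀ t, A t,
    (∀ t, ∀ ε > 0, ∃ x' ∈ carrier, ∀ᶠ s in 𝓝 t, ‖x s - x' s‖ ≤ ε) → x ∈ carrier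

variable {Ω : Type u} [TopologicalSpace Ω] {A : Ω → Type v}
  [∀ t, NonUnitalNormedRing (A t)] [∀ t, NormedSpace ℂ (A t)]

namespace ContinuousField

/-- A vector field `x` over `Y ⊆ Ω` is continuous at `t ∈ Y` (with respect to the field `U`). -/
def ContAt (U : ContinuousField Ω A) {Y : Set Ω} (x : ∀ t : Y, A t) (t : Y) : Prop :=
  ∀ ε > 0, ∃ x' ∈ U.carrier, ∀ᶠ s : Y in 𝓝 t, ‖x s - x' s‖ ≤ ε

theorem eventually_norm_le (U : ContinuousField Ω A) {x : ∀ t, A t} (hx : x ∈ U.carrier)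
    {Y : Set Ω} (t : Y) : ∀ᶠ s : Y in 𝓝 t, ‖x s‖ ≤ ‖x t‖ + 1 := by
  have h : Continuous fun s : Y => ‖x s‖ := (U.continuous_norm' x hx).comp continuous_subtype_val
  exact (h.continuousAt.eventually (gt_mem_nhds (lt_add_one ‖x t‖))).mono fun s hs => hs.le

theorem ContAt.mul {U : ContinuousField Ω A} {Y : Set Ω} {x y : ∀ t : Y, A t} {t : Y}
    (hx : U.ContAt x t) (hy : U.ContAt y t) : U.ContAt (x * y) t := by
  intro ε hε
  obtain ⟨y₁, hy₁, h₁⟩ := hy 1 one_pos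
  set M := ‖y₁ t‖ + 2
  have hM : 0 < M := by positivity
  obtain ⟨x', hx', h₂⟩ := hx (ε / (2 * M)) (by positivity)
  set N := ‖x' t‖ + 1
  have hN : 0 < N := by positivity
  obtain ⟨y', hy', h₃⟩ := hy (ε / (2 * N)) (by positivity)
  refine ⟨x' * y', U.mul_mem' hx' hy', ?_⟩
  filter_upwards [h₁, h₂, h₃, U.eventually_norm_le hy₁ t, U.eventually_norm_le hx' t]
    with s a₁ a₂ a₃ a₄ a₅
  have hyM : ‖y s‖ ≤ M := by
    have : ‖y s‖ ≤ ‖y s - y₁ s‖ + ‖y₁ s‖ := by simpa using norm_add_le (y s - y₁ s) (y₁ s)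
    simp only [M]; linarith
  have e : (x * y) s - (x' * y') s = (x s - x' s) * y s + x' s * (y s - y' s) := by
    simp [mul_sub, sub_mul]
  rw [e]
  calc _ ≤ ‖x s - x' s‖ * ‖y s‖ + ‖x' s‖ * ‖y s - y' s‖ :=
        (norm_add_le _ _).trans (add_le_add (norm_mul_le _ _) (norm_mul_le _ _))
    _ ≤ ε / (2 * M) * M + N * (ε / (2 * N)) := by gcongr
    _ = ε := by field_simp; norm_num

/-- The field `U|_Y` induced by `U` on a subset `Y`: its continuous vector fields are the vector
fields over `Y` that are continuous at every point of `Y`. -/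
def restrict (U : ContinuousField Ω A) (Y : Set Ω) : ContinuousField Y (fun t : Y => A t) where
  carrier := {x | ∀ t, U.ContAt x t}
  add_mem' := by
    intro x y hx hy t ε hε
    obtain ⟨x', hx', h₁⟩ := hx t (ε / 2) (half_pos hε)
    obtain ⟨y', hy', h₂⟩ := hy t (ε / 2) (half_pos hε)
    refine ⟨x' + y', U.add_mem' hx' hy', ?_⟩
    filter_upwards [h₁, h₂] with s a₁ a₂
    have e : (x + y) s - (x' + y') s = (x s - x' s) + (y s - y' s) := by
      simp only [Pi.add_apply]; abel
    rw [e]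
    linarith [norm_add_le (x s - x' s) (y s - y' s)]
  zero_mem' := fun t ε hε => ⟨0, U.zero_mem', by simp [hε.le]⟩
  mul_mem' := fun hx hy t => (hx t).mul (hy t)
  smul_mem' := by
    intro c x hx t ε hε
    obtain ⟨x', hx', h₁⟩ := hx t (ε / (‖c‖ + 1)) (by positivity)
    refine ⟨c • x', U.smul_mem' c hx', ?_⟩
    filter_upwards [h₁] with s a₁
    have e : (c • x) s - (c • x') s = c • (x s - x' s) := by simp [smul_sub]
    rw [e, norm_smul]
    calc ‖c‖ * ‖x s - x' s‖ ≤ (‖c‖ + 1) * (ε / (‖c‖ + 1)) := by gcongr; linarith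
      _ = ε := by field_simp
  dense' := fun t => (U.dense' t).mono (by
    rintro _ ⟨x, hx, rfl⟩
    exact ⟨fun s => x s, fun s ε hε => ⟨x, hx, by simp [hε.le]⟩, rfl⟩)
  continuous_norm' := by
    intro x hx
    refine continuous_iff_continuousAt.2 fun t => Metric.continuousAt_iff'.2 fun ε hε => ?_
    obtain ⟨x', hx', h₁⟩ := hx t (ε / 4) (by positivity)
    have h₂ : Continuous fun s : Y => ‖x' s‖ :=
      (U.continuous_norm' x' hx').comp continuous_subtype_val
    filter_upwards [h₁, Metric.continuousAt_iff'.1 h₂.continuousAt (ε / 4) (by positivity)]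
      with s a₁ a₂
    have a₃ := h₁.self_of_nhds
    have b₁ := (abs_le.1 ((abs_norm_sub_norm_le (x s) (x' s)).trans a₁))
    have b₃ := (abs_le.1 ((abs_norm_sub_norm_le (x t) (x' t)).trans a₃))
    rw [Real.dist_eq, abs_lt] at a₂ ⊢
    constructor <;> linarith [b₁.1, b₁.2, b₃.1, b₃.2, a₂.1, a₂.2]
  mem_of_local' := by
    intro x hx t ε hε
    obtain ⟨y, hy, h₁⟩ := hx t (ε / 2) (half_pos hε)
    obtain ⟨x', hx', h₂⟩ := hy t (ε / 2) (half_pos hε)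
    refine ⟨x', hx', ?_⟩
    filter_upwards [h₁, h₂] with s a₁ a₂
    linarith [norm_sub_le_norm_sub_add_norm_sub (x s) (y s) (x' s)]

/-- The constant field over `Ω` defined by `B`: all fibres are `B`, and the continuous vector fields
are the continuous maps `Ω → B`. -/
def const (Ω : Type u) [TopologicalSpace Ω] (B : Type v) [NonUnitalNormedRing B]
    [NormedSpace ℂ B] : ContinuousField Ω (fun _ => B) where
  carrier := {x | Continuous x}
  add_mem' := fun {_ _} (hx : Continuous _) (hy : Continuous _) => hx.add hy
  zero_mem' := show Continuous _ from continuous_const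
  mul_mem' := fun {_ _} (hx : Continuous _) (hy : Continuous _) => hx.mul hy
  smul_mem' := fun c _ (hx : Continuous _) => hx.const_smul c
  dense' := fun t => by
    have : {a : B | ∃ x ∈ {x : Ω → B | Continuous x}, x t = a} = Set.univ :=
      Set.eq_univ_of_forall fun a => ⟨fun _ => a, continuous_const, rfl⟩
    rw [this]
    exact dense_univ
  continuous_norm' := fun _ hx => Continuous.norm hx
  mem_of_local' := by
    intro x hx
    refine continuous_iff_continuousAt.2 fun t => Metric.continuousAt_iff'.2 fun ε hε => ?_
    obtain ⟨x', hx', h₁⟩ := hx t (ε / 4) (by positivity)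
    have h₂ : Continuous x' := hx'
    filter_upwards [h₁, Metric.continuousAt_iff'.1 h₂.continuousAt (ε / 4) (by positivity)]
      with s a₁ a₂
    have a₃ := h₁.self_of_nhds
    rw [← dist_eq_norm] at a₁ a₃
    rw [dist_comm] at a₃
    linarith [dist_triangle4 (x s) (x' s) (x' t) (x t)]

/-- An isomorphism of continuous fields over `Ω`: isometric algebra isomorphisms of the fibres that
carry the continuous vector fields of `U` onto those of `U'`. -/
structure Iso {A' : Ω → Type v} [∀ t, NonUnitalNormedRing (A' t)] [∀ t, NormedSpace ℂ (A' t)]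
    (U : ContinuousField Ω A) (U' : ContinuousField Ω A') where
  fibreMap : ∀ t, A t ≃ₗᵢ[ℂ] A' t
  map_mul : ∀ t (a b : A t), fibreMap t (a * b) = fibreMap t a * fibreMap t b
  mem_iff : ∀ x : ∀ t, A t, x ∈ U.carrier ↔ (fun t => fibreMap t (x t)) ∈ U'.carrier

/-- A field is trivial if it is isomorphic to the constant field of some Banach algebra. -/
def IsTrivial (U : ContinuousField Ω A) : Prop :=
  ∃ (B : Type v) (_ : NonUnitalNormedRing B) (_ : NormedSpace ℂ B) (_ : IsScalarTower ℂ B B)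
    (_ : SMulCommClass ℂ B B) (_ : CompleteSpace B), Nonempty (Iso U (const Ω B))

/-- Every point of `Ω` has a neighbourhood on which the induced field is trivial. -/
def IsLocallyTrivial (U : ContinuousField Ω A) : Prop :=
  ∀ t : Ω, ∃ V ∈ 𝓝 t, (U.restrict V).IsTrivial

/-- The continuous vector fields of `U` vanishing at infinity, as a subalgebra of the algebra of all
bounded vector fields with the supremum norm. (A continuous vector field that vanishes at infinity is
automatically bounded, see `exists_mem_sectionSubalgebra`.) -/
def sectionSubalgebra (U : ContinuousField Ω A) : NonUnitalSubalgebra ℂ (lp A ∞) where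
  carrier := {x | (x : ∀ t, A t) ∈ U.carrier ∧ Tendsto (fun t => ‖x t‖) (cocompact Ω) (𝓝 0)}
  add_mem' := by
    rintro x y ⟨hx, hx'⟩ ⟨hy, hy'⟩
    refine ⟨U.add_mem' hx hy, ?_⟩
    refine squeeze_zero (fun _ => norm_nonneg _) (fun t => norm_add_le (x t) (y t)) ?_
    simpa using hx'.add hy'
  zero_mem' := ⟨U.zero_mem', by simpa using tendsto_const_nhds⟩
  mul_mem' := by
    rintro x y ⟨hx, hx'⟩ ⟨hy, hy'⟩
    refine ⟨U.mul_mem' hx hy, ?_⟩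
    refine squeeze_zero (fun _ => norm_nonneg _) (fun t => norm_mul_le (x t) (y t)) ?_
    simpa using hx'.mul hy'
  smul_mem' := by
    rintro c x ⟨hx, hx'⟩
    refine ⟨U.smul_mem' c hx, ?_⟩
    refine squeeze_zero (fun _ => norm_nonneg _) (fun t => (norm_smul c (x t)).le) ?_
    simpa using hx'.const_mul ‖c‖

/-- The Banach algebra defined by the continuous field `U`. -/
abbrev Sections (U : ContinuousField Ω A) : Type max u v := U.sectionSubalgebra

theorem exists_mem_sectionSubalgebra (U : ContinuousField Ω A) {x : ∀ t, A t}
    (hx : x ∈ U.carrier) (h : Tendsto (fun t => ‖x t‖) (cocompact Ω) (𝓝 0)) :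
    ∃ a : U.Sections, ∀ t, (a : lp A ∞) t = x t := by
  have hb : BddAbove (Set.range fun t => ‖x t‖) := by
    obtain ⟨K, hK, hK'⟩ := mem_cocompact.1 (h.eventually (gt_mem_nhds one_pos))
    obtain ⟨C, hC⟩ := (hK.image (U.continuous_norm' x hx)).bddAbove
    refine ⟨max C 1, ?_⟩
    rintro _ ⟨t, rfl⟩
    by_cases ht : t ∈ K
    · exact le_max_of_le_left (hC ⟨t, ht, rfl⟩)
    · exact le_max_of_le_right (le_of_lt (hK' ht))
  exact ⟨⟨⟨x, memℓp_infty hb⟩, hx, h⟩, fun _ => rfl⟩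

instance (U : ContinuousField Ω A) : NormedSpace ℂ U.Sections :=
  U.sectionSubalgebra.toSubmodule.normedSpace

theorem norm_sections (U : ContinuousField Ω A) (a : U.Sections) :
    ‖a‖ = ⨆ t, ‖(a : lp A ∞) t‖ := rfl

instance (U : ContinuousField Ω A) [∀ t, CompleteSpace (A t)] : CompleteSpace U.Sections := by
  suffices h : IsClosed (U.sectionSubalgebra : Set (lp A ∞)) from h.completeSpace_coe
  refine isClosed_of_closure_subset fun x hx => ?_
  have key : ∀ ε > 0, ∃ y ∈ U.sectionSubalgebra, ∀ t, ‖x t - y t‖ ≤ ε := by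
    intro ε hε
    obtain ⟨y, hy, hxy⟩ := Metric.mem_closure_iff.1 hx ε hε
    refine ⟨y, hy, fun t => ?_⟩
    rw [dist_eq_norm] at hxy
    exact (lp.norm_apply_le_norm ENNReal.top_ne_zero (x - y) t).trans hxy.le
  refine ⟨U.mem_of_local' _ fun t ε hε => ?_, ?_⟩
  · obtain ⟨y, hy, h⟩ := key ε hε
    exact ⟨y, hy.1, Eventually.of_forall h⟩
  · refine Metric.tendsto_nhds.2 fun ε hε => ?_
    obtain ⟨y, hy, h⟩ := key (ε / 2) (half_pos hε)
    filter_upwards [hy.2.eventually (gt_mem_nhds (half_pos hε))] with t ht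
    have h1 : ‖x t‖ ≤ ‖x t - y t‖ + ‖y t‖ := by simpa using norm_add_le (x t - y t) (y t)
    rw [Real.dist_eq, sub_zero, abs_of_nonneg (norm_nonneg _)]
    linarith [h t]

end ContinuousField

end Fields

/-! ### Bimodules and the second continuous Hochschild cohomology group -/

section Cohomology

/-- A Banach `A`-bimodule structure on `X`: bounded bilinear actions `lact a x = a · x` and
`ract x a = x · a` satisfying the bimodule identities. -/
structure BanachBimodule (A : Type*) [NonUnitalNormedRing A] [NormedSpace ℂ A]
    (X : Type*) [NormedAddCommGroup X] [NormedSpace ℂ X] where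
  lact : A →L[ℂ] X →L[ℂ] X
  ract : X →L[ℂ] A →L[ℂ] X
  mul_lact : ∀ a b x, lact (a * b) x = lact a (lact b x)
  ract_mul : ∀ a b x, ract x (a * b) = ract (ract x a) b
  lact_ract : ∀ a b x, ract (lact a x) b = lact a (ract x b)

namespace BanachBimodule

variable {A : Type*} [NonUnitalNormedRing A] [NormedSpace ℂ A] [IsScalarTower ℂ A A]
  [SMulCommClass ℂ A A] {X : Type*} [NormedAddCommGroup X] [NormedSpace ℂ X]

/-- The coboundary of bounded 1-cochains: `(δ¹ g)(a, b) = a · g(b) - g(ab) + g(a) · b`. -/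
def delta1 (M : BanachBimodule A X) : (A →L[ℂ] X) →ₗ[ℂ] (A →L[ℂ] A →L[ℂ] X) where
  toFun g := ((ContinuousLinearMap.compL ℂ A X X).flip g).comp M.lact
    - (ContinuousLinearMap.compL ℂ A A X g).comp (ContinuousLinearMap.mul ℂ A) + M.ract.comp g
  map_add' g h := by ext a b; simp; abel
  map_smul' c g := by ext a b; simp [smul_sub, smul_add]

/-- The coboundary of bounded 2-cochains:
`(δ² f)(a, b, c) = a · f(b, c) - f(ab, c) + f(a, bc) - f(a, b) · c`. -/
def delta2 (M : BanachBimodule A X) :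
    (A →L[ℂ] A →L[ℂ] X) →ₗ[ℂ] (A →L[ℂ] A →L[ℂ] A →L[ℂ] X) where
  toFun f := ((ContinuousLinearMap.compL ℂ A (A →L[ℂ] X) (A →L[ℂ] X)).flip f).comp
      ((ContinuousLinearMap.compL ℂ A X X).comp M.lact)
    - (ContinuousLinearMap.compL ℂ A A (A →L[ℂ] X) f).comp (ContinuousLinearMap.mul ℂ A)
    + ((ContinuousLinearMap.compL ℂ A (A →L[ℂ] A) (A →L[ℂ] X)).flip
        (ContinuousLinearMap.mul ℂ A)).comp ((ContinuousLinearMap.compL ℂ A A X).comp f)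
    - (ContinuousLinearMap.compL ℂ A X (A →L[ℂ] X) M.ract).comp f
  map_add' f g := by ext a b c; simp; abel
  map_smul' r f := by ext a b c; simp [smul_sub, smul_add]

theorem delta1_apply (M : BanachBimodule A X) (g : A →L[ℂ] X) (a b : A) :
    M.delta1 g a b = M.lact a (g b) - g (a * b) + M.ract (g a) b := rfl

theorem delta2_apply (M : BanachBimodule A X) (f : A →L[ℂ] A →L[ℂ] X) (a b c : A) :
    M.delta2 f a b c
      = M.lact a (f b c) - f (a * b) c + f a (b * c) - M.ract (f a b) c := rfl

theorem delta2_delta1 (M : BanachBimodule A X) (g : A →L[ℂ] X) : M.delta2 (M.delta1 g) = 0 := by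
  ext a b c
  simp [delta2_apply, delta1_apply, M.mul_lact, M.ract_mul, M.lact_ract, mul_assoc]
  abel

/-- The bounded 2-cocycles `ker δ²`. -/
def Z2 (M : BanachBimodule A X) : Submodule ℂ (A →L[ℂ] A →L[ℂ] X) := LinearMap.ker M.delta2

/-- The bounded 2-coboundaries `im δ¹`, as a subspace of the 2-cocycles. -/
def B2 (M : BanachBimodule A X) : Submodule ℂ M.Z2 := (LinearMap.range M.delta1).comap M.Z2.subtype

/-- The second continuous Hochschild cohomology group `H²(A, X) = ker δ² / im δ¹`. -/
def H2 (M : BanachBimodule A X) : Type _ :=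
  @HasQuotient.Quotient M.Z2 (Submodule ℂ M.Z2)
    (@Submodule.hasQuotient ℂ M.Z2 Complex.commRing.toRing (Submodule.addCommGroup M.Z2) _) M.B2

instance (M : BanachBimodule A X) : AddCommGroup M.H2 :=
  @Submodule.Quotient.addCommGroup ℂ M.Z2 Complex.commRing.toRing (Submodule.addCommGroup M.Z2) _
    M.B2

/-- `H²(A, X) ≠ 0` exactly if some bounded 2-cocycle is not the coboundary of a bounded 1-cochain. -/
theorem nontrivial_H2_iff (M : BanachBimodule A X) :
    Nontrivial M.H2 ↔ ∃ f, M.delta2 f = 0 ∧ ∀ g, M.delta1 g ≠ f := by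
  have h : Nontrivial M.H2 ↔ M.B2 ≠ ⊤ :=
    @Submodule.Quotient.nontrivial_iff ℂ M.Z2 Complex.commRing.toRing (Submodule.addCommGroup M.Z2)
      _ M.B2
  rw [h, Ne, Submodule.eq_top_iff']
  constructor
  · intro h
    obtain ⟨f, hf⟩ := not_forall.1 h
    exact ⟨f, f.2, fun g hg => hf ⟨g, hg⟩⟩
  · rintro ⟨f, hf, hg⟩ h
    obtain ⟨g, hg'⟩ := h ⟨f, hf⟩
    exact hg g hg'

end BanachBimodule

end Cohomology

/-! ### Singular extensions -/

section Extensions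

variable {A : Type*} [NonUnitalNormedRing A] [NormedSpace ℂ A]
  {B : Type*} [NonUnitalNormedRing B] [NormedSpace ℂ B]

/-- The homomorphism `π : B → A` makes the Banach algebra `B` a singular extension of `A`: it is
continuous and onto, its kernel `I` satisfies `I² = 0`, and `I` is complemented in the Banach space
`B`, i.e. `π` has a bounded linear right inverse (admissibility). -/
structure IsSingularExtension (π : B →ₙₐ[ℂ] A) : Prop where
  continuous : Continuous π
  surjective : Function.Surjective π
  ker_mul : ∀ x y : B, π x = 0 → π y = 0 → x * y = 0
  admissible : ∃ s : A →L[ℂ] B, ∀ a, π (s a) = a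

/-- The extension `π : B → A` splits strongly: `π` has a right inverse that is a continuous algebra
homomorphism. -/
def SplitsStrongly (π : B →ₙₐ[ℂ] A) : Prop :=
  ∃ θ : A →ₙₐ[ℂ] B, Continuous θ ∧ ∀ a, π (θ a) = a

end Extensions

end BanachFields

end

open BanachFields

/-!
Write `𝔄 = U.Sections`. The derivations from `𝔄` to a left module with zero right action are the
morphisms of left modules. So `𝔄` is left projective exactly if the derivation `id : 𝔄 → 𝔄` lifts
along the linearly split surjection `𝔄₊ ⊗̂ 𝔄 → 𝔄`, and otherwise the obstruction is a nonzero class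
in `H²(𝔄, ker)`; a cocycle representing it defines an unsplittable singular extension.

It remains to see that projectivity of `𝔄` passes to the fibres with uniform bounds. A lift
`𝔄 → 𝔄₊ ⊗̂ 𝔄` followed by evaluation at `t` is a derivation over `𝔄 → A t`, so it vanishes on the
closed square `J` of the kernel of `𝔄 → A t`. It therefore descends to `A t` once `A t → 𝔄 / J` has
a bounded multiplicative section. If `𝔄` has an approximate identity, this is because `J` is the
whole kernel. If the field is locally trivial, an element of the fibre is spread along the
trivialization and cut off by `ψ` with `ψ t = 1`; this fails to be multiplicative only by a factor
`ψ - ψ²`, which is the square of a function vanishing at `t`.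
-/

noncomputable section

namespace BanachFields

/-! ### Bounded maps on projective tensor products -/

namespace ProjTensor

variable {E F G E' F' : Type*} [NormedAddCommGroup E] [NormedSpace ℂ E]
  [NormedAddCommGroup F] [NormedSpace ℂ F] [NormedAddCommGroup G] [NormedSpace ℂ G]
  [NormedAddCommGroup E'] [NormedSpace ℂ E'] [NormedAddCommGroup F'] [NormedSpace ℂ F']

theorem ext {f g : ProjTensor E F →L[ℂ] G} (h : ∀ x y, f (mk E F x y) = g (mk E F x y)) :
    f = g := by
  ext w
  refine UniformSpace.Completion.induction_on w (isClosed_eq f.continuous g.continuous) fun z => ?_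
  obtain ⟨l, rfl⟩ := exists_tensorOfList z
  induction l with
  | nil =>
    change f ((0 : AlgTensor E F) : ProjTensor E F) = g ((0 : AlgTensor E F) : ProjTensor E F)
    rw [UniformSpace.Completion.coe_zero, map_zero, map_zero]
  | cons p l ih =>
    rw [tensorOfList_cons, UniformSpace.Completion.coe_add, map_add, map_add, ih]
    exact congrArg (· + _) (h p.1 p.2)

theorem norm_mk_le : ‖mk E F‖ ≤ 1 := LinearMap.mkContinuous₂_norm_le _ zero_le_one _

theorem norm_lift_le [CompleteSpace G] (B : E →L[ℂ] F →L[ℂ] G) : ‖lift B‖ ≤ ‖B‖ := by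
  refine ContinuousLinearMap.opNorm_le_bound _ (norm_nonneg B) fun w => ?_
  refine UniformSpace.Completion.induction_on w
    (isClosed_le (by fun_prop) (by fun_prop)) fun z => ?_
  have lift_coe : lift B (z : ProjTensor E F) = algLift B z :=
    ContinuousLinearMap.extend_eq (algLift B)
      (e := (UniformSpace.Completion.toComplL : AlgTensor E F →L[ℂ] ProjTensor E F))
      UniformSpace.Completion.denseRange_coe
      (UniformSpace.Completion.isUniformInducing_coe _) z
  rw [lift_coe, UniformSpace.Completion.norm_coe]
  exact norm_algLift_le B z

theorem norm_map_le (S : E →L[ℂ] E') (T : F →L[ℂ] F') : ‖map S T‖ ≤ ‖S‖ * ‖T‖ := by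
  refine (norm_lift_le _).trans
    (ContinuousLinearMap.opNorm_le_bound₂ _ (by positivity) fun x y => ?_)
  calc ‖mk E' F' (S x) (T y)‖ ≤ 1 * ‖S x‖ * ‖T y‖ := (mk E' F').le_of_opNorm₂_le_of_le
        norm_mk_le le_rfl le_rfl
    _ ≤ 1 * (‖S‖ * ‖x‖) * (‖T‖ * ‖y‖) := by gcongr <;> exact ContinuousLinearMap.le_opNorm _ _
    _ = ‖S‖ * ‖T‖ * ‖x‖ * ‖y‖ := by ring

theorem norm_map_le_one {S : E →L[ℂ] E'} {T : F →L[ℂ] F'} (hS : ‖S‖ ≤ 1) (hT : ‖T‖ ≤ 1) :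
    ‖map S T‖ ≤ 1 :=
  (norm_map_le S T).trans (mul_le_one₀ hS (norm_nonneg T) hT)

variable (E F E' F') in
/-- The bounded bilinear map `(S, T) ↦ S ⊗ T`. -/
def mapL : (E →L[ℂ] E') →L[ℂ] (F →L[ℂ] F') →L[ℂ] ProjTensor E F →L[ℂ] ProjTensor E' F' :=
  LinearMap.mkContinuous₂
    (LinearMap.mk₂ ℂ map
      (fun _ _ _ => ext fun _ _ => by simp [map_mk])
      (fun _ _ _ => ext fun _ _ => by simp [map_mk])
      (fun _ _ _ => ext fun _ _ => by simp [map_mk])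
      (fun _ _ _ => ext fun _ _ => by simp [map_mk])) 1
    fun S T => by simpa using norm_map_le S T

@[simp]
theorem mapL_apply (S : E →L[ℂ] E') (T : F →L[ℂ] F') : mapL E F E' F' S T = map S T := rfl

end ProjTensor

/-! ### Derivations and morphisms of bimodules -/

section Bilinear

variable {E F G : Type*} [NormedAddCommGroup E] [NormedSpace ℂ E]
  [NormedAddCommGroup F] [NormedSpace ℂ F] [NormedAddCommGroup G] [NormedSpace ℂ G]

/-- A bounded bilinear map with values in a subspace `K`, as a bounded bilinear map into `K`. -/
def codRestrict₂ (B : E →L[ℂ] F →L[ℂ] G) (K : Submodule ℂ G) (h : ∀ x y, B x y ∈ K) :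
    E →L[ℂ] F →L[ℂ] K :=
  LinearMap.mkContinuous₂
    (LinearMap.mk₂ ℂ (fun x y => (⟨B x y, h x y⟩ : K))
      (fun _ _ _ => Subtype.ext (by simp)) (fun _ _ _ => Subtype.ext (by simp))
      (fun _ _ _ => Subtype.ext (by simp)) (fun _ _ _ => Subtype.ext (by simp)))
    ‖B‖ fun x y => B.le_opNorm₂ x y

end Bilinear

namespace BanachBimodule

variable {A : Type*} [NonUnitalNormedRing A] [NormedSpace ℂ A]
  {X : Type*} [NormedAddCommGroup X] [NormedSpace ℂ X]
  {Y : Type*} [NormedAddCommGroup Y] [NormedSpace ℂ Y]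

/-- `D : A → X` is a derivation. A derivation into a bimodule whose right action is zero is a
morphism of left modules, and symmetrically. -/
def IsDerivation (M : BanachBimodule A X) (D : A →L[ℂ] X) : Prop :=
  ∀ a b, D (a * b) = M.lact a (D b) + M.ract (D a) b

/-- `q : Y → X` is a morphism of bimodules. -/
structure IsMorphism (M : BanachBimodule A Y) (N : BanachBimodule A X) (q : Y →L[ℂ] X) :
    Prop where
  map_lact : ∀ a y, q (M.lact a y) = N.lact a (q y)
  map_ract : ∀ y a, q (M.ract y a) = N.ract (q y) a

theorem IsDerivation.comp_morphism {M : BanachBimodule A Y} {N : BanachBimodule A X}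
    {q : Y →L[ℂ] X} {D : A →L[ℂ] Y} (hD : M.IsDerivation D) (hq : IsMorphism M N q) :
    N.IsDerivation (q.comp D) := fun a b => by
  simp [hD a b, hq.map_lact, hq.map_ract]

/-- The kernel of a morphism of bimodules, as a bimodule. -/
def IsMorphism.kerBimodule {M : BanachBimodule A Y} {N : BanachBimodule A X} {q : Y →L[ℂ] X}
    (hq : IsMorphism M N q) : BanachBimodule A (LinearMap.ker q.toLinearMap) where
  lact := codRestrict₂ (M.lact.bilinearComp (.id ℂ A) (Submodule.subtypeL _)) _ fun a y => by
    simp [hq.map_lact]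
  ract := codRestrict₂ (M.ract.bilinearComp (Submodule.subtypeL _) (.id ℂ A)) _ fun y a => by
    simp [hq.map_ract]
  mul_lact a b y := Subtype.ext (M.mul_lact a b y)
  ract_mul a b y := Subtype.ext (M.ract_mul a b y)
  lact_ract a b y := Subtype.ext (M.lact_ract a b y)

/-- The bimodule obtained by restricting scalars along a multiplicative map `τ : R → A`. -/
def comap {R : Type*} [NonUnitalNormedRing R] [NormedSpace ℂ R] (M : BanachBimodule A X)
    (τ : R →L[ℂ] A) (hτ : ∀ a b, τ (a * b) = τ a * τ b) : BanachBimodule R X where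
  lact := M.lact.comp τ
  ract := M.ract.bilinearComp (.id ℂ X) τ
  mul_lact a b x := by simp [hτ, M.mul_lact]
  ract_mul a b x := by simp [hτ, M.ract_mul]
  lact_ract a b x := by simp [M.lact_ract]

/-- A left module as a bimodule with zero right action. -/
def ofLeft (act : A →L[ℂ] X →L[ℂ] X) (act_mul : ∀ a b, act (a * b) = (act a).comp (act b)) :
    BanachBimodule A X where
  lact := act
  ract := 0
  mul_lact a b x := congr($(act_mul a b) x)
  ract_mul a b x := by simp
  lact_ract a b x := by simp

/-- A right module as a bimodule with zero left action; `act a x` is `x · a`. -/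
def ofRight (act : A →L[ℂ] X →L[ℂ] X) (act_mul : ∀ a b, act (a * b) = (act b).comp (act a)) :
    BanachBimodule A X where
  lact := 0
  ract := act.flip
  mul_lact a b x := by simp
  ract_mul a b x := congr($(act_mul a b) x)
  lact_ract a b x := by simp

theorem isDerivation_ofLeft {act : A →L[ℂ] X →L[ℂ] X} {act_mul} {D : A →L[ℂ] X} :
    (ofLeft act act_mul).IsDerivation D ↔ ∀ a b, D (a * b) = act a (D b) := by
  simp [IsDerivation, ofLeft]

theorem isDerivation_ofRight {act : A →L[ℂ] X →L[ℂ] X} {act_mul} {D : A →L[ℂ] X} :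
    (ofRight act act_mul).IsDerivation D ↔ ∀ a b, D (a * b) = act b (D a) := by
  simp [IsDerivation, ofRight]

theorem IsMorphism.ofLeft {actY : A →L[ℂ] Y →L[ℂ] Y} {actX : A →L[ℂ] X →L[ℂ] X} {actY_mul actX_mul}
    {q : Y →L[ℂ] X} (hq : ∀ a, q.comp (actY a) = (actX a).comp q) :
    IsMorphism (ofLeft actY actY_mul) (ofLeft actX actX_mul) q :=
  ⟨fun a y => congr($(hq a) y), fun y a => by simp [BanachBimodule.ofLeft]⟩

theorem IsMorphism.ofRight {actY : A →L[ℂ] Y →L[ℂ] Y} {actX : A →L[ℂ] X →L[ℂ] X}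
    {actY_mul actX_mul} {q : Y →L[ℂ] X} (hq : ∀ a, q.comp (actY a) = (actX a).comp q) :
    IsMorphism (ofRight actY actY_mul) (ofRight actX actX_mul) q :=
  ⟨fun a y => by simp [BanachBimodule.ofRight], fun y a => congr($(hq a) y)⟩

section Regular

variable [IsScalarTower ℂ A A] [SMulCommClass ℂ A A]

theorem delta1_eq_zero_iff {M : BanachBimodule A X} {D : A →L[ℂ] X} :
    M.delta1 D = 0 ↔ M.IsDerivation D := by
  have h : ∀ a b, M.delta1 D a b = 0 ↔ D (a * b) = M.lact a (D b) + M.ract (D a) b := fun a b => by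
    rw [delta1_apply, sub_add_eq_add_sub, sub_eq_zero, eq_comm]
  exact ⟨fun hD a b => (h a b).1 (by simp [hD]), fun hD => by ext a b; exact (h a b).2 (hD a b)⟩

/-- The obstruction to lifting `D` is the class of `δ¹(σ ∘ D)`, its image under the connecting
homomorphism `H¹(A, X) → H²(A, ker q)`. -/
theorem IsMorphism.nontrivial_H2_kerBimodule {M : BanachBimodule A Y} {N : BanachBimodule A X}
    {q : Y →L[ℂ] X} (hq : IsMorphism M N q) {σ : X →L[ℂ] Y} (hσ : ∀ x, q (σ x) = x)
    {D : A →L[ℂ] X} (hD : N.IsDerivation D)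
    (hlift : ¬ ∃ ρ, M.IsDerivation ρ ∧ ∀ a, q (ρ a) = D a) : Nontrivial hq.kerBimodule.H2 := by
  have coboundary_mem_ker : ∀ a b, M.delta1 (σ.comp D) a b ∈ LinearMap.ker q.toLinearMap := by
    intro a b
    simp [delta1_apply, hq.map_lact, hq.map_ract, hσ, hD a b]
  refine (nontrivial_H2_iff _).2 ⟨codRestrict₂ _ _ coboundary_mem_ker, ?_, fun g hg => hlift ?_⟩
  · ext a b c : 4
    exact congr($(M.delta2_delta1 (σ.comp D)) a b c)
  · refine ⟨σ.comp D - (Submodule.subtypeL _).comp g, delta1_eq_zero_iff.1 ?_, fun a => ?_⟩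
    · rw [map_sub, sub_eq_zero]
      ext a b
      exact congr(($hg a b : Y)).symm
    · have hga : q (g a) = 0 := (g a).2
      simp [hσ, hga]

variable (A) in
/-- `A` as a left module over itself. -/
def leftRegular : BanachBimodule A A :=
  ofLeft (.mul ℂ A) fun a b => by ext x; simp [mul_assoc]

variable (A) in
/-- `A` as a right module over itself. -/
def rightRegular : BanachBimodule A A :=
  ofRight (ContinuousLinearMap.mul ℂ A).flip fun a b => by ext x; simp [mul_assoc]

theorem isDerivation_id_leftRegular : (leftRegular A).IsDerivation (.id ℂ A) :=
  isDerivation_ofLeft.2 fun _ _ => rfl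

theorem isDerivation_id_rightRegular : (rightRegular A).IsDerivation (.id ℂ A) :=
  isDerivation_ofRight.2 fun _ _ => rfl

end Regular

end BanachBimodule

/-! ### The singular extension defined by a cocycle -/

section SingularExtension

variable {A : Type*} [NonUnitalNormedRing A] [NormedSpace ℂ A] [IsScalarTower ℂ A A]
  [SMulCommClass ℂ A A] {X : Type*} [NormedAddCommGroup X] [NormedSpace ℂ X]
  {M : BanachBimodule A X}

/-- The singular extension of `A` by `X` defined by a 2-cocycle `f`, on the Banach space `A × X`.
The product `(a, x)(b, y) = (ab, a · y + x · b + f(a, b))` is only bounded, so it is divided by a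
bound for its norm; to compensate, the projection to `A` and the linear section are rescaled. -/
def SingularExtension (_f : M.Z2) : Type _ := A × X

namespace SingularExtension

instance instNormedAddCommGroup (f : M.Z2) : NormedAddCommGroup (SingularExtension f) :=
  inferInstanceAs (NormedAddCommGroup (A × X))

instance (f : M.Z2) : NormedSpace ℂ (SingularExtension f) :=
  inferInstanceAs (NormedSpace ℂ (A × X))

instance (f : M.Z2) [CompleteSpace A] [CompleteSpace X] : CompleteSpace (SingularExtension f) :=
  inferInstanceAs (CompleteSpace (A × X))

/-- The product `(a, x)(b, y) = (ab, a · y + x · b + f(a, b))`, before normalization. -/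
def rawMul (f : M.Z2) :
    SingularExtension f →L[ℂ] SingularExtension f →L[ℂ] SingularExtension f :=
  let fst := ContinuousLinearMap.fst ℂ A X
  let snd := ContinuousLinearMap.snd ℂ A X
  ((ContinuousLinearMap.compL ℂ (A × X) A (A × X) (.inl ℂ A X)).comp
      ((ContinuousLinearMap.mul ℂ A).bilinearComp fst fst)
    + (ContinuousLinearMap.compL ℂ (A × X) X (A × X) (.inr ℂ A X)).comp
      (M.lact.bilinearComp fst snd + M.ract.bilinearComp snd fst + f.1.bilinearComp fst fst) :
    A × X →L[ℂ] A × X →L[ℂ] A × X)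

theorem fst_rawMul (f : M.Z2) (u v : SingularExtension f) : (rawMul f u v).1 = u.1 * v.1 :=
  add_zero (u.1 * v.1)

theorem snd_rawMul (f : M.Z2) (u v : SingularExtension f) :
    (rawMul f u v).2 = M.lact u.1 v.2 + M.ract u.2 v.1 + f.1 u.1 v.1 :=
  zero_add (M.lact u.1 v.2 + M.ract u.2 v.1 + f.1 u.1 v.1)

theorem rawMul_assoc (f : M.Z2) (u v w : SingularExtension f) :
    rawMul f (rawMul f u v) w = rawMul f u (rawMul f v w) := by
  have cocycle := congr($(LinearMap.mem_ker.1 f.2) u.1 v.1 w.1)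
  simp only [BanachBimodule.delta2_apply, zero_apply] at cocycle
  refine Prod.ext (by simp only [fst_rawMul, mul_assoc]) ?_
  simp only [fst_rawMul, snd_rawMul, map_add, add_apply, M.mul_lact, M.ract_mul, M.lact_ract]
  rw [← sub_eq_zero, ← neg_eq_zero, ← cocycle]
  abel

/-- A positive bound for the norm of `rawMul f`. -/
def scale (f : M.Z2) : ℝ := ‖rawMul f‖ + 1

theorem scale_pos (f : M.Z2) : 0 < scale f := by unfold scale; positivity

theorem scale_ne_zero (f : M.Z2) : (scale f : ℂ) ≠ 0 := mod_cast (scale_pos f).ne'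

instance (f : M.Z2) : Mul (SingularExtension f) where
  mul u v := (scale f : ℂ)⁻¹ • rawMul f u v

theorem mul_def {f : M.Z2} (u v : SingularExtension f) :
    u * v = (scale f : ℂ)⁻¹ • rawMul f u v := rfl

instance (f : M.Z2) : NonUnitalNormedRing (SingularExtension f) where
  __ := instNormedAddCommGroup f
  left_distrib u v w := by simp [mul_def]
  right_distrib u v w := by simp [mul_def]
  zero_mul u := by simp [mul_def]
  mul_zero u := by simp [mul_def]
  mul_assoc u v w := by simp [mul_def, rawMul_assoc]
  norm_mul_le u v := by
    have norm_scale : ‖(scale f : ℂ)‖ = scale f := by simp [(scale_pos f).le]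
    rw [mul_def, norm_smul, norm_inv, norm_scale, inv_mul_le_iff₀ (scale_pos f), ← mul_assoc]
    exact (rawMul f).le_of_opNorm₂_le_of_le (by simp [scale]) le_rfl le_rfl

instance (f : M.Z2) : IsScalarTower ℂ (SingularExtension f) (SingularExtension f) :=
  ⟨fun c u v => by simp [mul_def, smul_comm c]⟩

instance (f : M.Z2) : SMulCommClass ℂ (SingularExtension f) (SingularExtension f) :=
  ⟨fun c u v => by simp [mul_def, smul_comm c]⟩

/-- The projection to `A`, rescaled to be multiplicative. -/
def proj (f : M.Z2) : SingularExtension f →ₙₐ[ℂ] A where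
  toFun u := (scale f : ℂ)⁻¹ • u.1
  map_smul' c u := smul_comm _ _ _
  map_zero' := smul_zero _
  map_add' u v := smul_add _ _ _
  map_mul' u v := by
    change (scale f : ℂ)⁻¹ • (scale f : ℂ)⁻¹ • (rawMul f u v).1 = _
    rw [fst_rawMul, smul_mul_smul_comm, smul_smul]

theorem proj_apply (f : M.Z2) (u : SingularExtension f) : proj f u = (scale f : ℂ)⁻¹ • u.1 := rfl

theorem fst_of_proj_eq {f : M.Z2} {u : SingularExtension f} {a : A} (h : proj f u = a) :
    u.1 = (scale f : ℂ) • a := by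
  rw [← h, proj_apply, smul_inv_smul₀ (scale_ne_zero f)]

theorem isSingularExtension_proj (f : M.Z2) : IsSingularExtension (proj f) := by
  let s : A →L[ℂ] SingularExtension f := (scale f : ℂ) • ContinuousLinearMap.inl ℂ A X
  have proj_s : ∀ a, proj f (s a) = a := fun a => inv_smul_smul₀ (scale_ne_zero f) a
  refine ⟨continuous_fst.const_smul (scale f : ℂ)⁻¹, fun a => ⟨s a, proj_s a⟩, fun u v hu hv => ?_,
    s, proj_s⟩
  have hu' : u.1 = 0 := by simpa using fst_of_proj_eq hu
  have hv' : v.1 = 0 := by simpa using fst_of_proj_eq hv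
  have raw_eq_zero : rawMul f u v = 0 :=
    Prod.ext (by rw [fst_rawMul, hu', zero_mul]; rfl)
      (by simp only [snd_rawMul, hu', hv', map_zero, zero_apply, add_zero]; rfl)
  rw [mul_def, raw_eq_zero, smul_zero]

theorem mem_range_delta1_of_splitsStrongly (f : M.Z2) (hf : SplitsStrongly (proj f)) :
    f.1 ∈ LinearMap.range M.delta1 := by
  obtain ⟨θ, hθ, proj_θ⟩ := hf
  have hc := scale_ne_zero f
  set c : ℂ := ↑(scale f)
  have fst_θ : ∀ a, (θ a).1 = c • a := fun a => fst_of_proj_eq (proj_θ a)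
  let θL : A →L[ℂ] SingularExtension f := ⟨(θ : A →ₗ[ℂ] SingularExtension f), hθ⟩
  let h : A →L[ℂ] X := (ContinuousLinearMap.snd ℂ A X).comp θL
  have h_mul : ∀ a b, h (a * b) = M.lact a (h b) + M.ract (h a) b + c • f.1 a b := fun a b =>
    calc h (a * b) = c⁻¹ • (rawMul f (θ a) (θ b)).2 := congr(($(map_mul θ a b)).2)
      _ = c⁻¹ • (M.lact (c • a) (h b) + M.ract (h a) (c • b) + f.1 (c • a) (c • b)) := by
        rw [snd_rawMul, fst_θ, fst_θ]; rfl
      _ = M.lact a (h b) + M.ract (h a) b + c • f.1 a b := by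
        simp only [map_smul, smul_apply, ← smul_add, inv_smul_smul₀ hc]
  have delta1_h : M.delta1 h = -c • f.1 := by
    ext a b
    change M.delta1 h a b = -c • f.1 a b
    rw [M.delta1_apply, h_mul, neg_smul]
    abel
  exact ⟨(-c)⁻¹ • h, by rw [map_smul, delta1_h, inv_smul_smul₀ (neg_ne_zero.2 hc)]⟩

end SingularExtension

end SingularExtension

theorem exists_unsplit_singularExtension {A X : Type u} [NonUnitalNormedRing A] [NormedSpace ℂ A]
    [IsScalarTower ℂ A A] [SMulCommClass ℂ A A] [CompleteSpace A] [NormedAddCommGroup X]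
    [NormedSpace ℂ X] [CompleteSpace X] (M : BanachBimodule A X) [Nontrivial M.H2] :
    ∃ (B : Type u) (_ : NonUnitalNormedRing B) (_ : NormedSpace ℂ B) (_ : IsScalarTower ℂ B B)
      (_ : SMulCommClass ℂ B B) (_ : CompleteSpace B) (π : B →ₙₐ[ℂ] A),
      IsSingularExtension π ∧ ¬ SplitsStrongly π := by
  obtain ⟨f, hf, not_coboundary⟩ := M.nontrivial_H2_iff.1 ‹_›
  refine ⟨SingularExtension (M := M) ⟨f, hf⟩, inferInstance, inferInstance, inferInstance,
    inferInstance, inferInstance, SingularExtension.proj _,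
    SingularExtension.isSingularExtension_proj _, fun h => ?_⟩
  obtain ⟨g, hg⟩ := SingularExtension.mem_range_delta1_of_splitsStrongly _ h
  exact not_coboundary g hg

/-! ### Projectivity as lifting of derivations -/

namespace AdjoinOne

theorem ext {A : Type*} {p q : AdjoinOne A} (fst_eq : p.ofLp.fst = q.ofLp.fst)
    (snd_eq : p.ofLp.snd = q.ofLp.snd) : p = q :=
  WithLp.ofLp_injective 1 (Unitization.ext fst_eq snd_eq)

variable {A : Type*} [NonUnitalNormedRing A] [NormedSpace ℂ A] [IsScalarTower ℂ A A]
  [SMulCommClass ℂ A A]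

variable (A) in
/-- The inclusion of `A` in `A₊` as a bounded linear map. -/
def inclL : A →L[ℂ] AdjoinOne A :=
  LinearMap.mkContinuous
    { toFun := incl
      map_add' := fun a b => ext (by simp [incl]) (by simp [incl])
      map_smul' := fun c a => ext (by simp [incl]) (by simp [incl]) } 1
    fun a => by rw [one_mul]; exact (WithLp.unitization_norm_inr a).le

@[simp]
theorem inclL_apply (a : A) : inclL A a = incl a := rfl

theorem incl_mul (a b : A) : incl (a * b) = incl a * incl b :=
  ext (by simp [incl]) (by simp [incl])

variable {R : Type*} [NonUnitalNormedRing R] [NormedSpace ℂ R] [IsScalarTower ℂ R R]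
  [SMulCommClass ℂ R R]

/-- The bounded linear map `R₊ → A₊`, `λe + x ↦ λe + τ x`, induced by `τ : R → A`. -/
def map (τ : R →L[ℂ] A) : AdjoinOne R →L[ℂ] AdjoinOne A :=
  LinearMap.mkContinuous
    { toFun := fun p => WithLp.toLp 1
        (Unitization.inl p.ofLp.fst + (τ p.ofLp.snd : Unitization ℂ A))
      map_add' := fun p q => ext (by simp) (by simp)
      map_smul' := fun c p => ext (by simp) (by simp) } (max 1 ‖τ‖) fun p => by
    simp only [LinearMap.coe_mk, AddHom.coe_mk, WithLp.unitization_norm_def, Unitization.fst_add,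
      Unitization.fst_inl, Unitization.fst_inr, add_zero, Unitization.snd_add,
      Unitization.snd_inl, Unitization.snd_inr, zero_add, mul_add]
    exact add_le_add (le_mul_of_one_le_left (norm_nonneg _) (le_max_left _ _))
      (τ.le_of_opNorm_le (le_max_right _ _) _)

theorem norm_map_le (τ : R →L[ℂ] A) : ‖map τ‖ ≤ max 1 ‖τ‖ :=
  LinearMap.mkContinuous_norm_le _ (by positivity) _

theorem norm_map_le_one {τ : R →L[ℂ] A} (hτ : ‖τ‖ ≤ 1) : ‖map τ‖ ≤ 1 :=
  (norm_map_le τ).trans_eq (max_eq_left hτ)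

@[simp]
theorem fst_map (τ : R →L[ℂ] A) (p : AdjoinOne R) : (map τ p).ofLp.fst = p.ofLp.fst := by
  simp [map]

@[simp]
theorem snd_map (τ : R →L[ℂ] A) (p : AdjoinOne R) : (map τ p).ofLp.snd = τ p.ofLp.snd := by
  simp [map]

variable {τ : R →L[ℂ] A}

theorem map_incl_mul (hτ : ∀ x y, τ (x * y) = τ x * τ y) (x : R) (p : AdjoinOne R) :
    map τ (incl x * p) = incl (τ x) * map τ p :=
  ext (by simp [incl]) (by simp [incl, hτ])

theorem map_mul_incl (hτ : ∀ x y, τ (x * y) = τ x * τ y) (p : AdjoinOne R) (x : R) :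
    map τ (p * incl x) = map τ p * incl (τ x) :=
  ext (by simp [incl]) (by simp [incl, hτ])

end AdjoinOne

section TensorBimodules

variable {A : Type*} [NonUnitalNormedRing A] [NormedSpace ℂ A] [IsScalarTower ℂ A A]
  [SMulCommClass ℂ A A]

theorem unitizationLeftMul_apply (p : AdjoinOne A) (x : A) :
    unitizationLeftMul A p x = p.ofLp.fst • x + p.ofLp.snd * x := rfl

theorem unitizationLeftMul_one (x : A) : unitizationLeftMul A 1 x = x := by
  change (1 : ℂ) • x + 0 * x = x
  rw [one_smul, zero_mul, add_zero]

theorem unitizationRightMul_apply (x : A) (p : AdjoinOne A) :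
    unitizationRightMul A x p = p.ofLp.fst • x + x * p.ofLp.snd := rfl

theorem unitizationRightMul_one (x : A) : unitizationRightMul A x 1 = x := by
  change (1 : ℂ) • x + x * 0 = x
  rw [one_smul, mul_zero, add_zero]

variable (A) in
/-- `A₊ ⊗̂ A` with the left action `a · (u ⊗ x) = au ⊗ x`. -/
def leftTensorBimodule : BanachBimodule A (ProjTensor (AdjoinOne A) A) :=
  .ofLeft (((ProjTensor.mapL _ _ _ _).flip (.id ℂ A)).comp
      ((ContinuousLinearMap.mul ℂ (AdjoinOne A)).comp (AdjoinOne.inclL A))) fun a b =>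
    ProjTensor.ext fun u x => by simp [ProjTensor.map_mk, AdjoinOne.incl_mul, mul_assoc]

variable (A) in
/-- `A ⊗̂ A₊` with the right action `(x ⊗ u) · a = x ⊗ ua`. -/
def rightTensorBimodule : BanachBimodule A (ProjTensor A (AdjoinOne A)) :=
  .ofRight ((ProjTensor.mapL _ _ _ _ (.id ℂ A)).comp
      ((ContinuousLinearMap.mul ℂ (AdjoinOne A)).flip.comp (AdjoinOne.inclL A))) fun a b =>
    ProjTensor.ext fun x u => by simp [ProjTensor.map_mk, AdjoinOne.incl_mul, mul_assoc]

variable [CompleteSpace A]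

theorem isLeftProjectiveSection_iff {ρ : A →L[ℂ] ProjTensor (AdjoinOne A) A} :
    IsLeftProjectiveSection ρ ↔ (leftTensorBimodule A).IsDerivation ρ ∧
      ∀ b, ProjTensor.lift (unitizationLeftMul A) (ρ b) = b := by
  rw [leftTensorBimodule, BanachBimodule.isDerivation_ofLeft]
  exact ⟨fun h => ⟨h.map_mul, h.right_inv⟩, fun h => ⟨h.1, h.2⟩⟩

theorem isRightProjectiveSection_iff {ρ : A →L[ℂ] ProjTensor A (AdjoinOne A)} :
    IsRightProjectiveSection ρ ↔ (rightTensorBimodule A).IsDerivation ρ ∧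
      ∀ b, ProjTensor.lift (unitizationRightMul A) (ρ b) = b := by
  rw [rightTensorBimodule, BanachBimodule.isDerivation_ofRight]
  exact ⟨fun h => ⟨h.map_mul, h.right_inv⟩, fun h => ⟨h.1, h.2⟩⟩

variable (A) in
theorem isMorphism_lift_unitizationLeftMul :
    BanachBimodule.IsMorphism (leftTensorBimodule A) (.leftRegular A)
      (ProjTensor.lift (unitizationLeftMul A)) :=
  .ofLeft fun a => ProjTensor.ext fun u x => by
    simp [ProjTensor.map_mk, ProjTensor.lift_mk, unitizationLeftMul_apply, AdjoinOne.incl, add_mul,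
      mul_add, mul_assoc, mul_smul_comm, smul_mul_assoc, WithLp.unitization_mul]

variable (A) in
theorem isMorphism_lift_unitizationRightMul :
    BanachBimodule.IsMorphism (rightTensorBimodule A) (.rightRegular A)
      (ProjTensor.lift (unitizationRightMul A)) :=
  .ofRight fun a => ProjTensor.ext fun x u => by
    simp [ProjTensor.map_mk, ProjTensor.lift_mk, unitizationRightMul_apply, AdjoinOne.incl, mul_add,
      mul_assoc, mul_smul_comm, WithLp.unitization_mul]

theorem nontrivial_H2_of_not_leftProjective (h : ¬ ∃ ρ, IsLeftProjectiveSection (A := A) ρ) :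
    Nontrivial (isMorphism_lift_unitizationLeftMul A).kerBimodule.H2 :=
  BanachBimodule.IsMorphism.nontrivial_H2_kerBimodule _ (σ := ProjTensor.mk _ _ 1)
    (fun x => by simp [ProjTensor.lift_mk, unitizationLeftMul_one])
    BanachBimodule.isDerivation_id_leftRegular
    fun ⟨ρ, hρ⟩ => h ⟨ρ, isLeftProjectiveSection_iff.2 hρ⟩

theorem nontrivial_H2_of_not_rightProjective (h : ¬ ∃ ρ, IsRightProjectiveSection (A := A) ρ) :
    Nontrivial (isMorphism_lift_unitizationRightMul A).kerBimodule.H2 :=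
  BanachBimodule.IsMorphism.nontrivial_H2_kerBimodule _ (σ := (ProjTensor.mk _ _).flip 1)
    (fun x => by simp [ProjTensor.lift_mk, unitizationRightMul_one])
    BanachBimodule.isDerivation_id_rightRegular
    fun ⟨ρ, hρ⟩ => h ⟨ρ, isRightProjectiveSection_iff.2 hρ⟩

end TensorBimodules

/-! ### Descent of projectivity to a quotient algebra -/

section Descent

variable {R : Type*} [NonUnitalNormedRing R] [NormedSpace ℂ R] [IsScalarTower ℂ R R]
  [SMulCommClass ℂ R R] {A : Type*} [NonUnitalNormedRing A] [NormedSpace ℂ A]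
  {Y : Type*} [NormedAddCommGroup Y] [NormedSpace ℂ Y]

/-- The closed linear span of the products of two elements of `I`. -/
def closedSq (I : Submodule ℂ R) : Submodule ℂ R :=
  (Submodule.map₂ (LinearMap.mul ℂ R) I I).topologicalClosure

theorem mul_mem_closedSq {I : Submodule ℂ R} {x y : R} (hx : x ∈ I) (hy : y ∈ I) :
    x * y ∈ closedSq I :=
  Submodule.le_topologicalClosure _ (Submodule.apply_mem_map₂ _ hx hy)

theorem closedSq_le {I K : Submodule ℂ R} (hK : IsClosed (K : Set R))
    (h : ∀ x ∈ I, ∀ y ∈ I, x * y ∈ K) : closedSq I ≤ K :=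
  Submodule.topologicalClosure_minimal _ (Submodule.map₂_le.2 h) hK

/-- `s` is a bounded right inverse of `τ : R → A`, not necessarily linear or multiplicative, which
becomes so modulo the closed square of the kernel of `τ`. -/
structure IsLift (τ : R →L[ℂ] A) (s : A → R) (C : ℝ) : Prop where
  apply_lift : ∀ v, τ (s v) = v
  norm_le : ∀ v, ‖s v‖ ≤ C * ‖v‖
  add_mem : ∀ v w, s (v + w) - (s v + s w) ∈ closedSq (LinearMap.ker τ.toLinearMap)
  smul_mem : ∀ (c : ℂ) v, s (c • v) - c • s v ∈ closedSq (LinearMap.ker τ.toLinearMap)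
  mul_mem : ∀ v w, s (v * w) - s v * s w ∈ closedSq (LinearMap.ker τ.toLinearMap)

theorem IsLift.of_ker_le {τ : R →L[ℂ] A} (hτ : ∀ x y, τ (x * y) = τ x * τ y)
    (hker : LinearMap.ker τ.toLinearMap ≤ closedSq (LinearMap.ker τ.toLinearMap)) {s : A → R}
    {C : ℝ} (apply_lift : ∀ v, τ (s v) = v) (norm_le : ∀ v, ‖s v‖ ≤ C * ‖v‖) : IsLift τ s C where
  apply_lift := apply_lift
  norm_le := norm_le
  add_mem v w := hker (by simp [apply_lift])
  smul_mem c v := hker (by simp [apply_lift])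
  mul_mem v w := hker (by simp [apply_lift, hτ])

variable {τ : R →L[ℂ] A} {hτ : ∀ x y, τ (x * y) = τ x * τ y} {M : BanachBimodule A Y}
  {T : R →L[ℂ] Y}

theorem BanachBimodule.IsDerivation.eq_zero_of_mem_closedSq_ker
    (hT : (M.comap τ hτ).IsDerivation T) {z : R}
    (hz : z ∈ closedSq (LinearMap.ker τ.toLinearMap)) : T z = 0 := by
  refine closedSq_le (K := LinearMap.ker T.toLinearMap) T.isClosed_ker (fun x hx y hy => ?_) hz
  have hx : τ x = 0 := hx
  have hy : τ y = 0 := hy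
  simp [hT x y, BanachBimodule.comap, hx, hy]

theorem BanachBimodule.IsDerivation.exists_descend (hT : (M.comap τ hτ).IsDerivation T)
    {s : A → R} {C : ℝ} (hs : IsLift τ s C) (hC : 0 ≤ C) :
    ∃ S : A →L[ℂ] Y, M.IsDerivation S ∧ (∀ v, S v = T (s v)) ∧ ‖S‖ ≤ ‖T‖ * C := by
  have map_congr : ∀ {x y}, x - y ∈ closedSq (LinearMap.ker τ.toLinearMap) → T x = T y :=
    fun h => sub_eq_zero.1 ((map_sub T _ _).symm.trans (hT.eq_zero_of_mem_closedSq_ker h))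
  let S : A →ₗ[ℂ] Y :=
    { toFun := fun v => T (s v)
      map_add' := fun v w => (map_congr (hs.add_mem v w)).trans (map_add T _ _)
      map_smul' := fun c v => (map_congr (hs.smul_mem c v)).trans (map_smul T c _) }
  have norm_S : ∀ v, ‖S v‖ ≤ ‖T‖ * C * ‖v‖ := fun v => by
    rw [mul_assoc]
    exact T.le_opNorm_of_le (hs.norm_le v)
  refine ⟨S.mkContinuous _ norm_S, fun v w => ?_, fun v => rfl,
    LinearMap.mkContinuous_norm_le _ (by positivity) _⟩
  calc T (s (v * w)) = T (s v * s w) := map_congr (hs.mul_mem v w)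
    _ = M.lact (τ (s v)) (T (s w)) + M.ract (T (s v)) (τ (s w)) := hT _ _
    _ = M.lact v (T (s w)) + M.ract (T (s v)) w := by rw [hs.apply_lift, hs.apply_lift]

end Descent

section ProjectiveDescent

variable {R : Type*} [NonUnitalNormedRing R] [NormedSpace ℂ R] [IsScalarTower ℂ R R]
  [SMulCommClass ℂ R R] {A : Type*} [NonUnitalNormedRing A] [NormedSpace ℂ A]
  [IsScalarTower ℂ A A] [SMulCommClass ℂ A A] {τ : R →L[ℂ] A}

theorem isMorphism_map_leftTensorBimodule (hτ : ∀ x y, τ (x * y) = τ x * τ y) :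
    BanachBimodule.IsMorphism (leftTensorBimodule R) ((leftTensorBimodule A).comap τ hτ)
      (ProjTensor.map (AdjoinOne.map τ) τ) where
  map_lact a w := by
    have comp_lact : (ProjTensor.map (AdjoinOne.map τ) τ).comp ((leftTensorBimodule R).lact a) =
        ((leftTensorBimodule A).lact (τ a)).comp (ProjTensor.map (AdjoinOne.map τ) τ) :=
      ProjTensor.ext fun u x => by
        simp [leftTensorBimodule, BanachBimodule.ofLeft, ProjTensor.map_mk,
          AdjoinOne.map_incl_mul hτ]
    exact congr($comp_lact w)
  map_ract w a := by simp [leftTensorBimodule, BanachBimodule.ofLeft, BanachBimodule.comap]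

theorem isMorphism_map_rightTensorBimodule (hτ : ∀ x y, τ (x * y) = τ x * τ y) :
    BanachBimodule.IsMorphism (rightTensorBimodule R) ((rightTensorBimodule A).comap τ hτ)
      (ProjTensor.map τ (AdjoinOne.map τ)) where
  map_lact a w := by simp [rightTensorBimodule, BanachBimodule.ofRight, BanachBimodule.comap]
  map_ract w a := by
    have comp_ract : (ProjTensor.map τ (AdjoinOne.map τ)).comp
        ((rightTensorBimodule R).ract.flip a) =
        ((rightTensorBimodule A).ract.flip (τ a)).comp (ProjTensor.map τ (AdjoinOne.map τ)) :=
      ProjTensor.ext fun x u => by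
        simp [rightTensorBimodule, BanachBimodule.ofRight, ProjTensor.map_mk,
          AdjoinOne.map_mul_incl hτ]
    exact congr($comp_ract w)

variable [CompleteSpace A]

theorem lift_unitizationLeftMul_map [CompleteSpace R] (hτ : ∀ x y, τ (x * y) = τ x * τ y)
    (w : ProjTensor (AdjoinOne R) R) :
    ProjTensor.lift (unitizationLeftMul A) (ProjTensor.map (AdjoinOne.map τ) τ w) =
      τ (ProjTensor.lift (unitizationLeftMul R) w) := by
  have lift_comp_map : (ProjTensor.lift (unitizationLeftMul A)).comp
      (ProjTensor.map (AdjoinOne.map τ) τ) =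
      τ.comp (ProjTensor.lift (unitizationLeftMul R)) :=
    ProjTensor.ext fun u x => by
      simp [ProjTensor.map_mk, ProjTensor.lift_mk, unitizationLeftMul_apply, hτ]
  exact congr($lift_comp_map w)

theorem lift_unitizationRightMul_map [CompleteSpace R] (hτ : ∀ x y, τ (x * y) = τ x * τ y)
    (w : ProjTensor R (AdjoinOne R)) :
    ProjTensor.lift (unitizationRightMul A) (ProjTensor.map τ (AdjoinOne.map τ) w) =
      τ (ProjTensor.lift (unitizationRightMul R) w) := by
  have lift_comp_map : (ProjTensor.lift (unitizationRightMul A)).comp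
      (ProjTensor.map τ (AdjoinOne.map τ)) =
      τ.comp (ProjTensor.lift (unitizationRightMul R)) :=
    ProjTensor.ext fun x u => by
      simp [ProjTensor.map_mk, ProjTensor.lift_mk, unitizationRightMul_apply, hτ]
  exact congr($lift_comp_map w)

variable [CompleteSpace R] {s : A → R} {C : ℝ}

theorem IsLeftProjectiveSection.exists_descend {ρ : R →L[ℂ] ProjTensor (AdjoinOne R) R}
    (hρ : IsLeftProjectiveSection ρ) (hτ : ∀ x y, τ (x * y) = τ x * τ y) (hτ1 : ‖τ‖ ≤ 1)
    (hs : IsLift τ s C) (hC : 0 ≤ C) :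
    ∃ ρ' : A →L[ℂ] ProjTensor (AdjoinOne A) A, IsLeftProjectiveSection ρ' ∧ ‖ρ'‖ ≤ ‖ρ‖ * C := by
  obtain ⟨hρ_der, hρ_inv⟩ := isLeftProjectiveSection_iff.1 hρ
  obtain ⟨ρ', hρ', ρ'_apply, norm_ρ'⟩ :=
    (hρ_der.comp_morphism (isMorphism_map_leftTensorBimodule hτ)).exists_descend hs hC
  refine ⟨ρ', isLeftProjectiveSection_iff.2 ⟨hρ', fun v => ?_⟩, norm_ρ'.trans ?_⟩
  · rw [ρ'_apply, ContinuousLinearMap.comp_apply, lift_unitizationLeftMul_map hτ, hρ_inv,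
      hs.apply_lift]
  · gcongr
    exact (ContinuousLinearMap.opNorm_comp_le _ _).trans
      (mul_le_of_le_one_left (norm_nonneg ρ)
        (ProjTensor.norm_map_le_one (AdjoinOne.norm_map_le_one hτ1) hτ1))

theorem IsRightProjectiveSection.exists_descend {ρ : R →L[ℂ] ProjTensor R (AdjoinOne R)}
    (hρ : IsRightProjectiveSection ρ) (hτ : ∀ x y, τ (x * y) = τ x * τ y) (hτ1 : ‖τ‖ ≤ 1)
    (hs : IsLift τ s C) (hC : 0 ≤ C) :
    ∃ ρ' : A →L[ℂ] ProjTensor A (AdjoinOne A), IsRightProjectiveSection ρ' ∧ ‖ρ'‖ ≤ ‖ρ‖ * C := by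
  obtain ⟨hρ_der, hρ_inv⟩ := isRightProjectiveSection_iff.1 hρ
  obtain ⟨ρ', hρ', ρ'_apply, norm_ρ'⟩ :=
    (hρ_der.comp_morphism (isMorphism_map_rightTensorBimodule hτ)).exists_descend hs hC
  refine ⟨ρ', isRightProjectiveSection_iff.2 ⟨hρ', fun v => ?_⟩, norm_ρ'.trans ?_⟩
  · rw [ρ'_apply, ContinuousLinearMap.comp_apply, lift_unitizationRightMul_map hτ, hρ_inv,
      hs.apply_lift]
  · gcongr
    exact (ContinuousLinearMap.opNorm_comp_le _ _).trans
      (mul_le_of_le_one_left (norm_nonneg ρ)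
        (ProjTensor.norm_map_le_one hτ1 (AdjoinOne.norm_map_le_one hτ1)))

end ProjectiveDescent

section Uniform

variable {R : Type*} [NonUnitalNormedRing R] [NormedSpace ℂ R] [IsScalarTower ℂ R R]
  [SMulCommClass ℂ R R] [CompleteSpace R] {Ω : Type*} {A : Ω → Type*}
  [∀ t, NonUnitalNormedRing (A t)] [∀ t, NormedSpace ℂ (A t)]
  [∀ t, IsScalarTower ℂ (A t) (A t)] [∀ t, SMulCommClass ℂ (A t) (A t)]
  [∀ t, CompleteSpace (A t)] {τ : ∀ t, R →L[ℂ] A t} {C : ℝ}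

theorem uniformlyLeftProjective_of_isLift (hτ : ∀ t x y, τ t (x * y) = τ t x * τ t y)
    (hτ1 : ∀ t, ‖τ t‖ ≤ 1) (hC : 0 ≤ C) (hs : ∀ t, ∃ s, IsLift (τ t) s C)
    (hR : ∃ ρ, IsLeftProjectiveSection (A := R) ρ) : UniformlyLeftProjective A := by
  obtain ⟨ρ, hρ⟩ := hR
  choose s hs using hs
  choose ρ' hρ' norm_ρ' using fun t => hρ.exists_descend (hτ t) (hτ1 t) (hs t) hC
  exact ⟨ρ', hρ', ‖ρ‖ * C, Set.forall_mem_range.2 norm_ρ'⟩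

theorem uniformlyRightProjective_of_isLift (hτ : ∀ t x y, τ t (x * y) = τ t x * τ t y)
    (hτ1 : ∀ t, ‖τ t‖ ≤ 1) (hC : 0 ≤ C) (hs : ∀ t, ∃ s, IsLift (τ t) s C)
    (hR : ∃ ρ, IsRightProjectiveSection (A := R) ρ) : UniformlyRightProjective A := by
  obtain ⟨ρ, hρ⟩ := hR
  choose s hs using hs
  choose ρ' hρ' norm_ρ' using fun t => hρ.exists_descend (hτ t) (hτ1 t) (hs t) hC
  exact ⟨ρ', hρ', ‖ρ‖ * C, Set.forall_mem_range.2 norm_ρ'⟩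

end Uniform

/-! ### Sections of continuous fields -/

namespace ContinuousField

variable {Ω : Type u} [TopologicalSpace Ω] {A : Ω → Type v} [∀ t, NonUnitalNormedRing (A t)]
  [∀ t, NormedSpace ℂ (A t)] (U : ContinuousField Ω A)

/-- The evaluation at `t` of continuous vector fields vanishing at infinity. -/
def eval (t : Ω) : U.Sections →L[ℂ] A t :=
  LinearMap.mkContinuous
    { toFun := fun a => (a : lp A ∞) t
      map_add' := fun _ _ => rfl
      map_smul' := fun _ _ => rfl } 1
    fun a => (lp.norm_apply_le_norm ENNReal.top_ne_zero _ t).trans_eq (one_mul ‖a‖).symm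

theorem eval_mul (t : Ω) (a b : U.Sections) : U.eval t (a * b) = U.eval t a * U.eval t b := rfl

theorem norm_eval_le_one (t : Ω) : ‖U.eval t‖ ≤ 1 :=
  LinearMap.mkContinuous_norm_le _ zero_le_one _

theorem norm_eval_apply_le (t : Ω) (a : U.Sections) : ‖U.eval t a‖ ≤ ‖a‖ :=
  (U.eval t).le_of_opNorm_le (U.norm_eval_le_one t) a |>.trans_eq (one_mul _)

theorem tendsto_norm_eval (a : U.Sections) :
    Tendsto (fun t => ‖U.eval t a‖) (cocompact Ω) (𝓝 0) := a.2.2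

theorem eval_mem_carrier (a : U.Sections) : (fun t => U.eval t a) ∈ U.carrier := a.2.1

theorem continuous_norm_eval (a : U.Sections) : Continuous fun t => ‖U.eval t a‖ :=
  U.continuous_norm' _ (U.eval_mem_carrier a)

variable {U} in
theorem sections_ext {a b : U.Sections} (h : ∀ t, U.eval t a = U.eval t b) : a = b :=
  Subtype.ext (lp.ext (funext h))

variable {U} in
theorem norm_le_of_forall_eval_le {a : U.Sections} {C : ℝ} (hC : 0 ≤ C)
    (h : ∀ t, ‖U.eval t a‖ ≤ C) : ‖a‖ ≤ C :=
  lp.norm_le_of_forall_le hC h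

variable {U} {φ : Ω → ℂ} {x : ∀ t, A t}

theorem smul_mem_carrier (hφ : Continuous φ) (hx : x ∈ U.carrier) :
    (fun t => φ t • x t) ∈ U.carrier := by
  refine U.mem_of_local' _ fun t ε hε => ⟨φ t • x, U.smul_mem' _ hx, ?_⟩
  have norm_sub : ∀ s, ‖φ s • x s - (φ t • x) s‖ = ‖φ s - φ t‖ * ‖x s‖ := fun s => by
    rw [Pi.smul_apply, ← sub_smul, norm_smul]
  have h : ContinuousAt (fun s => ‖φ s - φ t‖ * ‖x s‖) t :=
    ((hφ.sub continuous_const).norm.mul (U.continuous_norm' x hx)).continuousAt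
  simp only [norm_sub]
  exact h.eventually_le_const (by simpa using hε)

theorem smul_mem_carrier_of_restrict {V : Set Ω} (hφ : Continuous φ)
    (hV : tsupport φ ⊆ interior V) (hx : (fun s : V => x s) ∈ (U.restrict V).carrier) :
    (fun t => φ t • x t) ∈ U.carrier := by
  refine U.mem_of_local' _ fun t ε hε => ?_
  by_cases ht : t ∈ tsupport φ
  · have hVt : V ∈ 𝓝 t := mem_interior_iff_mem_nhds.1 (hV ht)
    obtain ⟨x', hx', x_near⟩ := hx ⟨t, mem_of_mem_nhds hVt⟩ (ε / (‖φ t‖ + 1)) (by positivity)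
    rw [nhds_subtype_eq_comap, eventually_comap] at x_near
    refine ⟨_, smul_mem_carrier hφ hx', ?_⟩
    filter_upwards [x_near, hVt, hφ.norm.continuousAt.eventually_le_const (lt_add_one ‖φ t‖)]
      with s x_sub_le hs φ_le
    calc ‖φ s • x s - φ s • x' s‖ = ‖φ s‖ * ‖x s - x' s‖ := by rw [← smul_sub, norm_smul]
      _ ≤ (‖φ t‖ + 1) * (ε / (‖φ t‖ + 1)) := by
        gcongr
        exact x_sub_le ⟨s, hs⟩ rfl
      _ = ε := mul_div_cancel₀ _ (by positivity)
  · refine ⟨0, U.zero_mem', ?_⟩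
    filter_upwards [notMem_tsupport_iff_eventuallyEq.1 ht] with s hs
    simp [hs, hε.le]

theorem exists_section_of_hasCompactSupport {V : Set Ω} (hφ : Continuous φ)
    (hc : HasCompactSupport φ) (hV : tsupport φ ⊆ interior V)
    (hx : (fun s : V => x s) ∈ (U.restrict V).carrier) :
    ∃ a : U.Sections, ∀ t, U.eval t a = φ t • x t := by
  refine U.exists_mem_sectionSubalgebra (smul_mem_carrier_of_restrict hφ hV hx)
    (tendsto_const_nhds.congr' ?_)
  filter_upwards [hc.isCompact.compl_mem_cocompact] with t ht
  simp [image_eq_zero_of_notMem_tsupport ht]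

theorem exists_smul_section (φ : BoundedContinuousFunction Ω ℂ) (a : U.Sections) :
    ∃ b : U.Sections, ∀ t, U.eval t b = φ t • U.eval t a := by
  refine U.exists_mem_sectionSubalgebra (smul_mem_carrier φ.continuous (U.eval_mem_carrier a))
    (squeeze_zero (fun _ => norm_nonneg _) (fun t => ?_)
      (by simpa using (U.tendsto_norm_eval a).const_mul ‖φ‖))
  rw [norm_smul]
  gcongr
  exact φ.norm_coe_le_norm t

variable (U) in
/-- Pointwise multiplication of sections by a bounded continuous scalar function. -/
def multiplier (φ : BoundedContinuousFunction Ω ℂ) : U.Sections →L[ℂ] U.Sections :=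
  have eval_choose : ∀ a t, U.eval t (exists_smul_section φ a).choose = φ t • U.eval t a :=
    fun a => (exists_smul_section φ a).choose_spec
  LinearMap.mkContinuous
    { toFun := fun a => (exists_smul_section φ a).choose
      map_add' := fun a b => sections_ext fun t => by
        rw [map_add, eval_choose, eval_choose, eval_choose, map_add, smul_add]
      map_smul' := fun c a => sections_ext fun t => by
        rw [map_smul, eval_choose, eval_choose, map_smul, smul_comm, RingHom.id_apply] } ‖φ‖
    fun a => norm_le_of_forall_eval_le (by positivity) fun t => by
      change ‖U.eval t (exists_smul_section φ a).choose‖ ≤ _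
      rw [eval_choose, norm_smul]
      exact mul_le_mul (φ.norm_coe_le_norm t) (U.norm_eval_apply_le t a) (norm_nonneg _)
        (norm_nonneg _)

@[simp]
theorem eval_multiplier (φ : BoundedContinuousFunction Ω ℂ) (a : U.Sections) (t : Ω) :
    U.eval t (U.multiplier φ a) = φ t • U.eval t a :=
  (exists_smul_section φ a).choose_spec t

theorem multiplier_mul_mul [∀ t, IsScalarTower ℂ (A t) (A t)] [∀ t, SMulCommClass ℂ (A t) (A t)]
    (φ ψ : BoundedContinuousFunction Ω ℂ) (a b : U.Sections) :
    U.multiplier (φ * ψ) (a * b) = U.multiplier φ a * U.multiplier ψ b :=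
  sections_ext fun t => by simp [eval_mul, smul_mul_smul_comm]

/-! ### Lifting the fibres of an algebra of sections with dense square -/

theorem exists_cutoff [LocallyCompactSpace Ω] [R1Space Ω] {t : Ω} {V : Set Ω} (hV : V ∈ 𝓝 t) :
    ∃ ψ : C(Ω, ℝ), ψ t = 1 ∧ HasCompactSupport ψ ∧ tsupport ψ ⊆ interior V ∧
      ∀ s, ψ s ∈ Set.Icc (0 : ℝ) 1 := by
  obtain ⟨ψ, ψ_one, ψ_compact, ψ_supp, ψ_Icc⟩ :=
    exists_continuousMap_one_of_isCompact_subset_isOpen (isCompact_singleton (x := t))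
      isOpen_interior (Set.singleton_subset_iff.2 (mem_interior_iff_mem_nhds.2 hV))
  exact ⟨ψ, ψ_one rfl, ψ_compact, ψ_supp, ψ_Icc⟩

section LocallyCompact

variable [LocallyCompactSpace Ω] [R1Space Ω]

theorem exists_section_norm_le (hx : x ∈ U.carrier) {t : Ω} {C : ℝ} (hC : ‖x t‖ < C) :
    ∃ a : U.Sections, U.eval t a = x t ∧ ‖a‖ ≤ C := by
  obtain ⟨ψ, ψ_one, ψ_compact, ψ_supp, ψ_Icc⟩ :=
    exists_cutoff ((U.continuous_norm' x hx).continuousAt.eventually_le_const hC)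
  obtain ⟨a, eval_a⟩ := exists_section_of_hasCompactSupport (V := Set.univ)
    (φ := fun s => (ψ s : ℂ)) (x := x) (by fun_prop) (ψ_compact.comp_left Complex.ofReal_zero)
    (by simp) (fun s ε hε => ⟨x, hx, by simp [hε.le]⟩)
  refine ⟨a, by simp [eval_a, ψ_one], norm_le_of_forall_eval_le
    ((norm_nonneg _).trans hC.le) fun s => ?_⟩
  rw [eval_a, norm_smul, Complex.norm_real, Real.norm_of_nonneg (ψ_Icc s).1]
  by_cases hs : s ∈ tsupport ψ
  · have norm_x_le : s ∈ {s | ‖x s‖ ≤ C} := interior_subset (ψ_supp hs)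
    exact (mul_le_of_le_one_left (norm_nonneg _) (ψ_Icc s).2).trans norm_x_le
  · simpa [image_eq_zero_of_notMem_tsupport hs] using (norm_nonneg _).trans hC.le

theorem exists_eval_eq_norm_le [∀ t, CompleteSpace (A t)] (t : Ω) (v : A t) :
    ∃ a : U.Sections, U.eval t a = v ∧ ‖a‖ ≤ 3 * ‖v‖ := by
  let evalHom : NormedAddGroupHom U.Sections (A t) :=
    (U.eval t : U.Sections →+ A t).mkNormedAddGroupHom _ (U.eval t).le_opNorm
  have eval_surjective_range : evalHom.SurjectiveOnWith evalHom.range 2 := by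
    rintro _ ⟨a, rfl⟩
    change ∃ b, U.eval t b = U.eval t a ∧ ‖b‖ ≤ 2 * ‖U.eval t a‖
    rcases eq_or_ne (U.eval t a) 0 with h | h
    · exact ⟨0, by simp [h], by simp⟩
    · exact exists_section_norm_le (U.eval_mem_carrier a)
        (lt_mul_of_one_lt_left (norm_pos_iff.2 h) one_lt_two)
  have dense_range : Dense (evalHom.range : Set (A t)) := (U.dense' t).mono <| by
    rintro _ ⟨x, hx, rfl⟩
    obtain ⟨a, ha, -⟩ := exists_section_norm_le hx (lt_add_one ‖x t‖)
    exact ⟨a, ha⟩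
  obtain ⟨a, ha, norm_a⟩ :=
    controlled_closure_of_complete two_pos one_pos eval_surjective_range v (dense_range v)
  exact ⟨a, ha, norm_a.trans_eq (by norm_num)⟩

theorem exists_multiplier_norm_sub_le {t : Ω} {c : U.Sections} (hc : U.eval t c = 0) {ε : ℝ}
    (hε : 0 < ε) : ∃ χ : BoundedContinuousFunction Ω ℂ, χ t = 0 ∧
      ‖c - U.multiplier (χ * χ) c‖ ≤ ε := by
  have near : ∀ᶠ s in 𝓝 t, ‖U.eval s c‖ ≤ ε :=
    (U.continuous_norm_eval c).continuousAt.eventually_le_const (by simpa [hc] using hε)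
  obtain ⟨ψ, ψ_one, -, ψ_supp, ψ_Icc⟩ := exists_cutoff near
  let χ : BoundedContinuousFunction Ω ℂ :=
    .ofNormedAddCommGroup (fun s => ((1 - ψ s : ℝ) : ℂ)) (by fun_prop) 1 fun s => by
      rw [Complex.norm_real, Real.norm_eq_abs, abs_le]
      constructor <;> linarith [(ψ_Icc s).1, (ψ_Icc s).2]
  have χ_apply : ∀ s, χ s = ((1 - ψ s : ℝ) : ℂ) := fun s => rfl
  refine ⟨χ, by simp [χ_apply, ψ_one], norm_le_of_forall_eval_le hε.le fun s => ?_⟩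
  have eval_sub : U.eval s (c - U.multiplier (χ * χ) c) =
      ((ψ s * (2 - ψ s) : ℝ) : ℂ) • U.eval s c := by
    rw [map_sub, eval_multiplier, BoundedContinuousFunction.coe_mul, Pi.mul_apply, χ_apply,
      ← Complex.ofReal_mul, sub_eq_iff_eq_add, ← add_smul, ← Complex.ofReal_add]
    ring_nf
    simp
  obtain ⟨ψ_nonneg, ψ_le_one⟩ := ψ_Icc s
  rw [eval_sub, norm_smul, Complex.norm_real, Real.norm_of_nonneg (by nlinarith)]
  by_cases hs : s ∈ tsupport ψ
  · have norm_eval_le : s ∈ {s | ‖U.eval s c‖ ≤ ε} := interior_subset (ψ_supp hs)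
    exact (mul_le_of_le_one_left (norm_nonneg _) (by nlinarith)).trans norm_eval_le
  · simpa [image_eq_zero_of_notMem_tsupport hs] using hε.le

variable [∀ t, IsScalarTower ℂ (A t) (A t)] [∀ t, SMulCommClass ℂ (A t) (A t)]

theorem ker_eval_le_closedSq (hU : closedSq (⊤ : Submodule ℂ U.Sections) = ⊤) (t : Ω) :
    LinearMap.ker (U.eval t).toLinearMap ≤ closedSq (LinearMap.ker (U.eval t).toLinearMap) := by
  intro c hc
  set K := closedSq (LinearMap.ker (U.eval t).toLinearMap)
  have isClosed_K : IsClosed (K : Set U.Sections) := Submodule.isClosed_topologicalClosure _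
  refine isClosed_K.closure_subset (Metric.mem_closure_iff.2 fun ε hε => ?_)
  obtain ⟨χ, χ_zero, norm_sub_le⟩ := exists_multiplier_norm_sub_le hc (half_pos hε)
  -- `χ ^ 2` maps products to products of sections vanishing at `t`, and products are total.
  have multiplier_mem : closedSq ⊤ ≤ K.comap (U.multiplier (χ * χ)).toLinearMap :=
    closedSq_le (isClosed_K.preimage (U.multiplier (χ * χ)).continuous) fun x _ y _ => by
      change U.multiplier (χ * χ) (x * y) ∈ K
      rw [multiplier_mul_mul]
      exact mul_mem_closedSq (by simp [χ_zero]) (by simp [χ_zero])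
  rw [hU] at multiplier_mem
  refine ⟨_, multiplier_mem (Submodule.mem_top (x := c)), ?_⟩
  rw [dist_eq_norm]
  exact norm_sub_le.trans_lt (half_lt_self hε)

theorem exists_isLift_of_closedSq_top [∀ t, CompleteSpace (A t)]
    (hU : closedSq (⊤ : Submodule ℂ U.Sections) = ⊤) (t : Ω) : ∃ s, IsLift (U.eval t) s 3 := by
  choose s eval_s norm_s using exists_eval_eq_norm_le (U := U) t
  exact ⟨s, .of_ker_le (U.eval_mul t) (ker_eval_le_closedSq hU t) eval_s norm_s⟩

end LocallyCompact

end ContinuousField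

/-! ### Locally trivial fields -/

namespace ContinuousField

variable {Ω : Type u} [TopologicalSpace Ω] {A : Ω → Type v} [∀ t, NonUnitalNormedRing (A t)]
  [∀ t, NormedSpace ℂ (A t)] {U : ContinuousField Ω A}

theorem Iso.symm_map_mul {A' : Ω → Type v} [∀ t, NonUnitalNormedRing (A' t)]
    [∀ t, NormedSpace ℂ (A' t)] {U' : ContinuousField Ω A'} (e : Iso U U') (t : Ω) (x y : A' t) :
    (e.fibreMap t).symm (x * y) = (e.fibreMap t).symm x * (e.fibreMap t).symm y :=
  (e.fibreMap t).injective (by simp [e.map_mul])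

theorem IsLocallyTrivial.exists_extension (hU : U.IsLocallyTrivial) (t : Ω) :
    ∃ V ∈ 𝓝 t, ∃ T : A t →ₗ[ℂ] ∀ s, A s, (∀ v, T v t = v) ∧ (∀ v s, ‖T v s‖ ≤ ‖v‖) ∧
      (∀ v w, T (v * w) = T v * T w) ∧ ∀ v, (fun s : V => T v s) ∈ (U.restrict V).carrier := by
  classical
  obtain ⟨V, hV, B, _, _, _, _, _, ⟨e⟩⟩ := hU t
  have ht : t ∈ V := mem_of_mem_nhds hV
  let transport (s : V) : A t →ₗ[ℂ] A s :=
    ((e.fibreMap s).symm.toLinearEquiv : B →ₗ[ℂ] A s) ∘ₗ (e.fibreMap ⟨t, ht⟩).toLinearEquiv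
  have transport_apply : ∀ s v,
      transport s v = (e.fibreMap s).symm (e.fibreMap ⟨t, ht⟩ v) := fun _ _ => rfl
  let T : A t →ₗ[ℂ] ∀ s, A s :=
    LinearMap.pi fun s => if hs : s ∈ V then transport ⟨s, hs⟩ else 0
  have T_of_mem : ∀ s (hs : s ∈ V) v, T v s = transport ⟨s, hs⟩ v := fun s hs v => by
    simp [T, hs]
  have T_of_notMem : ∀ s, s ∉ V → ∀ v, T v s = 0 := fun s hs v => by simp [T, hs]
  refine ⟨V, hV, T, fun v => ?_, fun v s => ?_, fun v w => funext fun s => ?_, fun v => ?_⟩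
  · rw [T_of_mem t ht, transport_apply]
    exact (e.fibreMap ⟨t, ht⟩).symm_apply_apply v
  · by_cases hs : s ∈ V
    · rw [T_of_mem s hs, transport_apply, LinearIsometryEquiv.norm_map]
      exact ((e.fibreMap ⟨t, ht⟩).norm_map v).le
    · simp [T_of_notMem s hs]
  · by_cases hs : s ∈ V
    · simp only [Pi.mul_apply, T_of_mem s hs, transport_apply]
      rw [← e.symm_map_mul]
      exact congrArg _ (e.map_mul ⟨t, ht⟩ v w)
    · simp [T_of_notMem s hs]
  · rw [e.mem_iff]
    simp only [T_of_mem _ (Subtype.prop _), transport_apply,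
      LinearIsometryEquiv.apply_symm_apply]
    exact continuous_const

variable [LocallyCompactSpace Ω] [R1Space Ω] [∀ t, IsScalarTower ℂ (A t) (A t)]
  [∀ t, SMulCommClass ℂ (A t) (A t)]

theorem exists_isLift_of_extension {t : Ω} {V : Set Ω} (hV : V ∈ 𝓝 t)
    {T : A t →ₗ[ℂ] ∀ s, A s} (T_self : ∀ v, T v t = v) (norm_T_le : ∀ v s, ‖T v s‖ ≤ ‖v‖)
    (T_mul : ∀ v w, T (v * w) = T v * T w)
    (T_mem : ∀ v, (fun s : V => T v s) ∈ (U.restrict V).carrier) :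
    ∃ s, IsLift (U.eval t) s 1 := by
  obtain ⟨ψ, ψ_one, ψ_compact, ψ_supp, ψ_Icc⟩ := exists_cutoff hV
  have exists_section : ∀ g : ℝ → ℂ, Continuous g → g 0 = 0 → ∀ v,
      ∃ a : U.Sections, ∀ s, U.eval s a = g (ψ s) • T v s := fun g hg g_zero v =>
    exists_section_of_hasCompactSupport (by fun_prop) (ψ_compact.comp_left g_zero)
      ((tsupport_comp_subset g_zero ψ).trans ψ_supp) (T_mem v)
  choose p eval_p using exists_section Complex.ofReal Complex.continuous_ofReal
    Complex.ofReal_zero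
  -- `p` is linear, and its failure to be multiplicative is `(ψ - ψ²) • T (v * w)`, a product of
  -- two sections vanishing at `t`.
  choose q eval_q using exists_section (fun r => (√(r - r * r) : ℝ)) (by fun_prop) (by simp)
  have q_mem : ∀ v, q v ∈ LinearMap.ker (U.eval t).toLinearMap := fun v => by
    simp [eval_q, ψ_one]
  have p_mul : ∀ v w, p (v * w) - p v * p w = q v * q w := fun v w => sections_ext fun s => by
    have sqrt_mul_sqrt : √(ψ s - ψ s * ψ s) * √(ψ s - ψ s * ψ s) = ψ s - ψ s * ψ s :=
      Real.mul_self_sqrt (by nlinarith [(ψ_Icc s).1, (ψ_Icc s).2])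
    simp only [map_sub, eval_mul, eval_p, eval_q, T_mul, Pi.mul_apply, smul_mul_smul_comm,
      ← Complex.ofReal_mul, sqrt_mul_sqrt, Complex.ofReal_sub, sub_smul]
  refine ⟨p, fun v => by simp [eval_p, ψ_one, T_self], fun v => ?_, fun v w => ?_, fun c v => ?_,
    fun v w => p_mul v w ▸ mul_mem_closedSq (q_mem v) (q_mem w)⟩
  · refine norm_le_of_forall_eval_le (by positivity) fun s => ?_
    rw [eval_p, norm_smul, Complex.norm_real, Real.norm_of_nonneg (ψ_Icc s).1]
    exact mul_le_mul (ψ_Icc s).2 (norm_T_le v s) (norm_nonneg _) zero_le_one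
  · have p_add : p (v + w) = p v + p w := sections_ext fun s => by simp [eval_p]
    simp [p_add]
  · have p_smul : p (c • v) = c • p v := sections_ext fun s => by simp [eval_p, smul_comm c]
    simp [p_smul]

theorem IsLocallyTrivial.exists_isLift (hU : U.IsLocallyTrivial) (t : Ω) :
    ∃ s, IsLift (U.eval t) s 1 := by
  obtain ⟨V, hV, T, T_self, norm_T_le, T_mul, T_mem⟩ := hU.exists_extension t
  exact exists_isLift_of_extension hV T_self norm_T_le T_mul T_mem

theorem exists_uniform_isLift [∀ t, CompleteSpace (A t)]
    (hU : closedSq (⊤ : Submodule ℂ U.Sections) = ⊤ ∨ U.IsLocallyTrivial) :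
    ∃ C, 0 ≤ C ∧ ∀ t, ∃ s, IsLift (U.eval t) s C := by
  rcases hU with hU | hU
  · exact ⟨3, by positivity, exists_isLift_of_closedSq_top hU⟩
  · exact ⟨1, by positivity, hU.exists_isLift⟩

end ContinuousField

section ApproximateIdentity

variable {R : Type*} [NonUnitalNormedRing R] [NormedSpace ℂ R] [IsScalarTower ℂ R R]
  [SMulCommClass ℂ R R]

theorem HasRightBoundedApproxId.closedSq_top (hR : HasRightBoundedApproxId R) :
    closedSq (⊤ : Submodule ℂ R) = ⊤ := by
  obtain ⟨l, _, -, hl⟩ := hR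
  exact eq_top_iff.2 fun a _ => (Submodule.isClosed_topologicalClosure _).mem_of_tendsto (hl a)
    (.of_forall fun _ => mul_mem_closedSq trivial trivial)

theorem HasLeftBoundedApproxId.closedSq_top (hR : HasLeftBoundedApproxId R) :
    closedSq (⊤ : Submodule ℂ R) = ⊤ := by
  obtain ⟨l, _, -, hl⟩ := hR
  exact eq_top_iff.2 fun a _ => (Submodule.isClosed_topologicalClosure _).mem_of_tendsto (hl a)
    (.of_forall fun _ => mul_mem_closedSq trivial trivial)

end ApproximateIdentity

end BanachFields

end

theorem proposition3p6_general {Ω : Type u} [TopologicalSpace Ω] [LocallyCompactSpace Ω]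
    [R1Space Ω] {A : Ω → Type v} [∀ t, NonUnitalNormedRing (A t)] [∀ t, NormedSpace ℂ (A t)]
    [∀ t, IsScalarTower ℂ (A t) (A t)] [∀ t, SMulCommClass ℂ (A t) (A t)]
    [∀ t, CompleteSpace (A t)] (U : ContinuousField Ω A)
    (hU : closedSq (⊤ : Submodule ℂ U.Sections) = ⊤ ∨ U.IsLocallyTrivial)
    (hA : ¬ UniformlyLeftProjective A ∨ ¬ UniformlyRightProjective A) :
    (∃ (X : Type max u v) (_ : NormedAddCommGroup X) (_ : NormedSpace ℂ X) (_ : CompleteSpace X)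
      (M : BanachBimodule U.Sections X), Nontrivial M.H2) ∧
    (∃ (B : Type max u v) (_ : NonUnitalNormedRing B) (_ : NormedSpace ℂ B)
      (_ : IsScalarTower ℂ B B) (_ : SMulCommClass ℂ B B) (_ : CompleteSpace B)
      (π : B →ₙₐ[ℂ] U.Sections), IsSingularExtension π ∧ ¬ SplitsStrongly π) := by
  obtain ⟨C, hC, hs⟩ := ContinuousField.exists_uniform_isLift hU
  have exists_H2 : ∃ (X : Type max u v) (_ : NormedAddCommGroup X) (_ : NormedSpace ℂ X)
      (_ : CompleteSpace X) (M : BanachBimodule U.Sections X), Nontrivial M.H2 := by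
    rcases hA with hA | hA
    · exact ⟨_, _, _, ContinuousLinearMap.isClosed_ker _ |>.completeSpace_coe, _,
        nontrivial_H2_of_not_leftProjective fun hR => hA <|
          uniformlyLeftProjective_of_isLift U.eval_mul U.norm_eval_le_one hC hs hR⟩
    · exact ⟨_, _, _, ContinuousLinearMap.isClosed_ker _ |>.completeSpace_coe, _,
        nontrivial_H2_of_not_rightProjective fun hR => hA <|
          uniformlyRightProjective_of_isLift U.eval_mul U.norm_eval_le_one hC hs hR⟩
  obtain ⟨X, _, _, _, M, hM⟩ := exists_H2
  exact ⟨⟨X, ‹_›, ‹_›, ‹_›, M, hM⟩, exists_unsplit_singularExtension M⟩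

theorem proposition3p6 {Ω : Type u} [TopologicalSpace Ω] [LocallyCompactSpace Ω] [T2Space Ω]
    {A : Ω → Type v} [∀ t, NonUnitalNormedRing (A t)] [∀ t, NormedSpace ℂ (A t)]
    [∀ t, IsScalarTower ℂ (A t) (A t)] [∀ t, SMulCommClass ℂ (A t) (A t)]
    [∀ t, CompleteSpace (A t)] (U : ContinuousField Ω A)
    (hU : HasRightBoundedApproxId U.Sections ∨ HasLeftBoundedApproxId U.Sections ∨
      U.IsLocallyTrivial)
    (hA : ¬ UniformlyLeftProjective A ∨ ¬ UniformlyRightProjective A) :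
    (∃ (X : Type max u v) (_ : NormedAddCommGroup X) (_ : NormedSpace ℂ X) (_ : CompleteSpace X)
      (M : BanachBimodule U.Sections X), Nontrivial M.H2) ∧
    (∃ (B : Type max u v) (_ : NonUnitalNormedRing B) (_ : NormedSpace ℂ B)
      (_ : IsScalarTower ℂ B B) (_ : SMulCommClass ℂ B B) (_ : CompleteSpace B)
      (π : B →ₙₐ[ℂ] U.Sections), IsSingularExtension π ∧ ¬ SplitsStrongly π) :=
  proposition3p6_general U
    (or_assoc.2 hU |>.imp_left (·.elim (·.closedSq_top) (·.closedSq_top))) hA
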